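/- Let $q\ge 3$ be an integer. The $q$-core of a graph is its maximal subgraph in which every vertex has degree at least $q$; a graph is said to have a $q$-core if this subgraph is nonempty. For $n\ge 2$ and $m\ge 0$ let $P_n(m)$ be the probability that a random graph on $n$ labelled vertices with $m$ random edges has a $q$-core, where the $m$ edges are chosen uniformly from the $\binom n2$ possible edges either (a) without replacement (so $0\le m\le\binom n2$), or (b) independently with replacement (repeated edges being identified). For $0<p_1<p_2<1$ let the width $\Delta_n(p_1,p_2)$ of the transition for the existence of a $q$-core be the least integer $\Delta\ge0$ such that $P_n(m)\le p_1$ and $P_n(m+\Delta)\ge p_2$ for some admissible $m$ (with $m+\Delta$ admissible too). Then the characteristic width is at least of order $\sqrt n$: there is a constant $c>0$ depending only on $q$ such that, for all fixed $0<p_1<p_2<1$, there is $n_0$ such that for all $n\ge n_0$ the width $\Delta_n(p_1,p_2)$ is well defined and $$\Delta_n(p_1,p_2)\ \ge\ c\,(p_2-p_1)\sqrt n ,$$ both for edges chosen without replacement and for edges chosen with replacement. -/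

import Mathlib

open Filter

namespace RandomGraphCore

section Core

variable {V : Type*}

/-- Every vertex of the subgraph `H` has degree at least `q` in `H`
(an infinite degree counts as larger than `q`). -/
def MinDegreeGE {G : SimpleGraph V} (q : ℕ) (H : G.Subgraph) : Prop :=
  ∀ v ∈ H.verts, (q : ℕ∞) ≤ (H.neighborSet v).encard

/-- The `q`-core of `G`: the maximal subgraph of `G` in which each vertex has degree at
least `q`. It may be empty. -/
def qCore (q : ℕ) (G : SimpleGraph V) : G.Subgraph :=
  sSup {H : G.Subgraph | MinDegreeGE q H}

/-- The `q`-core is indeed the largest subgraph of minimum degree at least `q`. -/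
theorem isGreatest_qCore (q : ℕ) (G : SimpleGraph V) :
    IsGreatest {H : G.Subgraph | MinDegreeGE q H} (qCore q G) := by
  refine ⟨?_, fun H hH => le_sSup hH⟩
  intro v hv
  simp only [qCore, SimpleGraph.Subgraph.verts_sSup, Set.mem_iUnion, exists_prop] at hv
  obtain ⟨H, hH, hvH⟩ := hv
  have hle : H ≤ qCore q G := le_sSup hH
  exact (hH v hvH).trans
    (Set.encard_le_encard (SimpleGraph.Subgraph.neighborSet_subset_of_subgraph hle v))

/-- `G` has a (nonempty) `q`-core. -/
def HasQCore (q : ℕ) (G : SimpleGraph V) : Prop :=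
  (qCore q G).verts.Nonempty

theorem hasQCore_iff (q : ℕ) (G : SimpleGraph V) :
    HasQCore q G ↔ ∃ H : G.Subgraph, H.verts.Nonempty ∧ MinDegreeGE q H := by
  constructor
  · intro h
    exact ⟨qCore q G, h, (isGreatest_qCore q G).1⟩
  · rintro ⟨H, hne, hH⟩
    exact hne.mono ((isGreatest_qCore q G).2 hH).1

end Core

noncomputable section

open Classical in
/-- The probability that a random graph on `n` vertices has a `q`-core when its edges are a
uniformly random set of `m` of the `n.choose 2` possible edges
(meaningful for `m ≤ n.choose 2`). -/
def coreProbWithoutRepl (q n m : ℕ) : ℝ :=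
  ((((⊤ : SimpleGraph (Fin n)).edgeFinset.powersetCard m).filter
      fun s => HasQCore q (SimpleGraph.fromEdgeSet (s : Set (Sym2 (Fin n))))).card : ℝ) /
    (((⊤ : SimpleGraph (Fin n)).edgeFinset.powersetCard m).card : ℝ)

open Classical in
/-- The probability that a random graph on `n` vertices has a `q`-core when its edges are
drawn by `m` independent uniform choices, with replacement, from the `n.choose 2` possible
edges (meaningful for `2 ≤ n`). -/
def coreProbWithRepl (q n m : ℕ) : ℝ :=
  (((Finset.univ : Finset (Fin m → (⊤ : SimpleGraph (Fin n)).edgeSet)).filter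
      fun f => HasQCore q
        (SimpleGraph.fromEdgeSet (Set.range fun i => (f i : Sym2 (Fin n))))).card : ℝ) /
    (Fintype.card (Fin m → (⊤ : SimpleGraph (Fin n)).edgeSet) : ℝ)

/-- The width of the transition of `P` from level `p₁` up to level `p₂`, where `P m` is
the probability at `m` items and `m` ranges over `I`: the least amount `Δ` by which `m` can be
increased so that `P` goes from at most `p₁` to at least `p₂`. (If no increase achieves this,
the value is `0`.) -/
def transitionWidth (I : Set ℕ) (P : ℕ → ℝ) (p₁ p₂ : ℝ) : ℕ :=
  sInf {Δ : ℕ | ∃ m : ℕ, m ∈ I ∧ m + Δ ∈ I ∧ P m ≤ p₁ ∧ p₂ ≤ P (m + Δ)}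

/-- Width of the `q`-core transition for random sets of edges (no replacement). -/
def coreWidthWithoutRepl (q n : ℕ) (p₁ p₂ : ℝ) : ℕ :=
  transitionWidth (Set.Iic (n.choose 2)) (coreProbWithoutRepl q n) p₁ p₂

/-- Width of the `q`-core transition for random edges drawn with replacement. -/
def coreWidthWithRepl (q n : ℕ) (p₁ p₂ : ℝ) : ℕ :=
  transitionWidth Set.univ (coreProbWithRepl q n) p₁ p₂

end

end RandomGraphCore

/-! Everything follows from one estimate: an extra edge raises the probability of a `q`-core by at
most `C / √n` (`exists_coreProb_succ_sub_le`). A climb of height `p₂ - p₁` then needs at least `(p₂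
- p₁) √n / C` edges.

For a linear number of edges, `G(n, m)` and `G(n, m + 1)` are both compared with `G(n + 1, m + 1)`.
Deleting an isolated vertex of the latter leaves a uniform `G(n, m + 1)`; deleting a vertex of
degree one leaves a uniform `G(n, m)`. Neither deletion affects the existence of a `q`-core. Hence
weighting the core indicator by the number `X` of isolated (or pendant) vertices turns its mean over
the large graph into its mean over the small one. By Cauchy–Schwarz the weighting costs at most the
relative standard deviation of `X`, which is `O(n ^ (-1/2))` because both counts have mean of order
`n` and such vertices are almost uncorrelated (`abs_coreProb_sub_isolated`,
`abs_coreProb_sub_pendant`).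

Outside that range the estimate is immediate: below `n / 64` edges a first moment bound gives
probability at most `2 / n` (`coreProb_le_of_sparse`), and beyond `(q - 1) n` edges a core is
certain (`coreProb_eq_one`).

Sampling with replacement is a mixture: given the number of distinct edges, the edge set is uniform,
and one more draw adds at most one edge, so the same bound holds (`sum_image_succ_sub_le`). -/

namespace RandomGraphCore

/-! ### Cores as a property of edge sets; invariance under relabelling -/

section EdgeSets

variable {V W : Type*}

/-- The possible edges between vertices of `S`. -/
def pairs [DecidableEq V] (S : Finset V) : Finset (Sym2 V) := S.sym2.filter fun e => ¬ e.IsDiag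

/-- The edge set `E` spans a nonempty subgraph of minimum degree at least `q`. -/
def EdgesHaveCore [DecidableEq V] (q : ℕ) (E : Finset (Sym2 V)) : Prop :=
  ∃ K : Finset V, K.Nonempty ∧ ∀ v ∈ K, q ≤ (K.filter fun w => w ≠ v ∧ s(v, w) ∈ E).card

open Classical in
/-- The indicator function of `EdgesHaveCore`. -/
noncomputable def coreInd [DecidableEq V] (q : ℕ) (E : Finset (Sym2 V)) : ℝ :=
  if EdgesHaveCore q E then 1 else 0

/-- The number of sets of `m` edges on the vertex set `S` that have a `q`-core. -/
noncomputable def coreCount [DecidableEq V] (q : ℕ) (S : Finset V) (m : ℕ) : ℝ :=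
  ∑ E ∈ (pairs S).powersetCard m, coreInd q E

variable [DecidableEq V] [DecidableEq W]

theorem mem_pairs {S : Finset V} {e : Sym2 V} :
    e ∈ pairs S ↔ (∀ v ∈ e, v ∈ S) ∧ ¬ e.IsDiag := by
  simp [pairs, Finset.mem_sym2_iff]

theorem mk_mem_pairs {S : Finset V} {v w : V} :
    s(v, w) ∈ pairs S ↔ v ∈ S ∧ w ∈ S ∧ v ≠ w := by
  simp [mem_pairs, and_assoc]

theorem pairs_mono {S T : Finset V} (h : S ⊆ T) : pairs S ⊆ pairs T := by
  intro e
  simp only [mem_pairs]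
  exact fun ⟨h₁, h₂⟩ => ⟨fun v hv => h (h₁ v hv), h₂⟩

theorem pairs_inter (S T : Finset V) : pairs (S ∩ T) = pairs S ∩ pairs T := by
  ext e
  simp only [mem_pairs, Finset.mem_inter]
  grind

theorem card_pairs (S : Finset V) : (pairs S).card = S.card.choose 2 := by
  rw [← Sym2.card_image_offDiag]
  congr 1
  ext e
  induction e with | _ a b =>
  simp only [mk_mem_pairs, Finset.mem_image, Finset.mem_offDiag, Prod.exists]
  grind

theorem pairs_map (φ : V ↪ W) (S : Finset V) :
    pairs (S.map φ) = (pairs S).map φ.sym2Map := by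
  ext e
  simp only [pairs, Finset.sym2_map, Finset.mem_filter, Finset.mem_map]
  constructor
  · rintro ⟨⟨a, ha, rfl⟩, h⟩
    refine ⟨a, ⟨ha, fun hd => h ?_⟩, rfl⟩
    induction a with | _ x y =>
    simp_all
  · rintro ⟨a, ⟨ha, h⟩, rfl⟩
    refine ⟨⟨a, ha, rfl⟩, fun hd => h ?_⟩
    induction a with | _ x y =>
    simp_all

theorem coreInd_nonneg (q : ℕ) (E : Finset (Sym2 V)) : 0 ≤ coreInd q E := by
  unfold coreInd; split_ifs <;> norm_num

theorem coreInd_le_one (q : ℕ) (E : Finset (Sym2 V)) : coreInd q E ≤ 1 := by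
  unfold coreInd; split_ifs <;> norm_num

theorem coreInd_sq (q : ℕ) (E : Finset (Sym2 V)) : coreInd q E ^ 2 = coreInd q E := by
  unfold coreInd; split_ifs <;> norm_num

theorem coreInd_congr {q : ℕ} {E : Finset (Sym2 V)} {F : Finset (Sym2 W)}
    (h : EdgesHaveCore q E ↔ EdgesHaveCore q F) : coreInd q E = coreInd q F := by
  by_cases hE : EdgesHaveCore q E
  · simp [coreInd, hE, h.1 hE]
  · simp [coreInd, hE, mt h.2 hE]

theorem EdgesHaveCore.mono {q : ℕ} {E F : Finset (Sym2 V)} (hEF : E ⊆ F)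
    (h : EdgesHaveCore q E) : EdgesHaveCore q F := by
  obtain ⟨K, hK, hd⟩ := h
  refine ⟨K, hK, fun v hv => (hd v hv).trans (Finset.card_le_card ?_)⟩
  intro w
  simp only [Finset.mem_filter]
  exact fun ⟨h₁, h₂, h₃⟩ => ⟨h₁, h₂, hEF h₃⟩

theorem not_edgesHaveCore_empty {q : ℕ} (hq : 1 ≤ q) :
    ¬ EdgesHaveCore q (∅ : Finset (Sym2 V)) := by
  rintro ⟨K, ⟨v, hv⟩, hd⟩
  have := hd v hv
  simp at this
  omega

theorem edgesHaveCore_map {q : ℕ} (hq : 1 ≤ q) (φ : V ↪ W) (E : Finset (Sym2 V)) :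
    EdgesHaveCore q (E.map φ.sym2Map) ↔ EdgesHaveCore q E := by
  have hmem (v w : V) : s(φ v, φ w) ∈ E.map φ.sym2Map ↔ s(v, w) ∈ E := by
    rw [← Finset.mem_map' φ.sym2Map]; rfl
  constructor
  · rintro ⟨K, hK, hd⟩
    -- As `q ≥ 1`, every core vertex lies on an edge, hence in the image of `φ`.
    have hr : ∀ v ∈ K, ∃ a, φ a = v := by
      intro v hv
      have h1 : 0 < (K.filter fun w => w ≠ v ∧ s(v, w) ∈ E.map φ.sym2Map).card :=
        lt_of_lt_of_le hq (hd v hv)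
      obtain ⟨w, hw⟩ := Finset.card_pos.1 h1
      simp only [Finset.mem_filter, Finset.mem_map] at hw
      obtain ⟨-, -, e, -, he⟩ := hw
      induction e with | _ a b =>
      have he' : s(φ a, φ b) = s(v, w) := he
      rw [Sym2.eq_iff] at he'
      grind
    have hKr : (K.preimage φ φ.injective.injOn).map φ = K := by
      ext v
      simp only [Finset.mem_map, Finset.mem_preimage]
      constructor
      · rintro ⟨a, ha, rfl⟩; exact ha
      · intro hv
        obtain ⟨a, rfl⟩ := hr v hv
        exact ⟨a, hv, rfl⟩
    refine ⟨K.preimage φ φ.injective.injOn, ?_, fun v hv => ?_⟩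
    · rw [← Finset.map_nonempty (f := φ), hKr]; exact hK
    · rw [Finset.mem_preimage] at hv
      refine (hd _ hv).trans (le_of_eq ?_)
      rw [← Finset.card_map φ]
      congr 1
      ext w
      simp only [Finset.mem_filter, Finset.mem_map, Finset.mem_preimage]
      constructor
      · rintro ⟨hw, hne, he⟩
        obtain ⟨b, rfl⟩ := hr w hw
        exact ⟨b, ⟨hw, fun h => hne (h ▸ rfl), (hmem _ _).1 (Finset.mem_map.2 he)⟩, rfl⟩
      · rintro ⟨b, ⟨hb, hne, he⟩, rfl⟩
        exact ⟨hb, fun h => hne (φ.injective h), Finset.mem_map.1 ((hmem _ _).2 he)⟩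
  · rintro ⟨K, hK, hd⟩
    refine ⟨K.map φ, hK.map, fun v hv => ?_⟩
    obtain ⟨a, ha, rfl⟩ := Finset.mem_map.1 hv
    refine (hd a ha).trans ?_
    rw [← Finset.card_map φ]
    refine Finset.card_le_card fun w hw => ?_
    obtain ⟨b, hb, rfl⟩ := Finset.mem_map.1 hw
    simp only [Finset.mem_filter] at hb ⊢
    exact ⟨Finset.mem_map_of_mem φ hb.1, fun h => hb.2.1 (φ.injective h), (hmem _ _).2 hb.2.2⟩

theorem coreCount_map {q : ℕ} (hq : 1 ≤ q) (φ : V ↪ W) (S : Finset V) (m : ℕ) :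
    coreCount q (S.map φ) m = coreCount q S m := by
  unfold coreCount
  rw [pairs_map, Finset.powersetCard_map, Finset.sum_map]
  refine Finset.sum_congr rfl fun E _ => ?_
  exact coreInd_congr (edgesHaveCore_map hq φ E)

/-- The number of edge sets with a `q`-core depends only on the number of vertices. -/
theorem coreCount_eq_card {q : ℕ} (hq : 1 ≤ q) (S : Finset V) (m : ℕ) :
    coreCount q S m = coreCount q (Finset.univ : Finset (Fin S.card)) m := by
  rw [← coreCount_map hq (S.equivFin.symm.toEmbedding.trans (Function.Embedding.subtype _))]
  congr 1
  ext v
  simp only [Finset.mem_map, Finset.mem_univ, true_and, Function.Embedding.trans_apply,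
    Equiv.coe_toEmbedding, Function.Embedding.subtype_apply]
  constructor
  · intro hv
    exact ⟨S.equivFin ⟨v, hv⟩, by simp⟩
  · rintro ⟨i, rfl⟩
    exact (S.equivFin.symm i).2

theorem coreCount_nonneg (q : ℕ) (S : Finset V) (m : ℕ) : 0 ≤ coreCount q S m :=
  Finset.sum_nonneg fun _ _ => coreInd_nonneg _ _

theorem coreCount_le (q : ℕ) (S : Finset V) (m : ℕ) :
    coreCount q S m ≤ ((S.card.choose 2).choose m : ℝ) := by
  refine (Finset.sum_le_sum fun E _ => coreInd_le_one q E).trans ?_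
  simp [card_pairs]

/-- Attaching a pendant edge at a new vertex does not create a core. -/
theorem edgesHaveCore_insert_pendant {q : ℕ} (hq : 2 ≤ q) {S : Finset V} {v w : V}
    {E : Finset (Sym2 V)} (hE : E ⊆ pairs (S.erase v)) :
    EdgesHaveCore q (insert s(v, w) E) ↔ EdgesHaveCore q E := by
  refine ⟨?_, fun h => h.mono (Finset.subset_insert _ _)⟩
  rintro ⟨K, hK, hd⟩
  have hvE : ∀ x, s(v, x) ∉ E := fun x hx => by
    have := mk_mem_pairs.1 (hE hx); simp at this
  have hvK : v ∉ K := by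
    intro hv
    have h1 := hd v hv
    have h2 : (K.filter fun x => x ≠ v ∧ s(v, x) ∈ insert s(v, w) E) ⊆ {w} := by
      intro x hx
      simp only [Finset.mem_filter, Finset.mem_insert, hvE, or_false, Sym2.eq_iff] at hx
      simp only [Finset.mem_singleton]
      grind
    have := Finset.card_le_card h2
    rw [Finset.card_singleton] at this
    omega
  refine ⟨K, hK, fun x hx => (hd x hx).trans (Finset.card_le_card ?_)⟩
  intro y
  simp only [Finset.mem_filter, Finset.mem_insert, Sym2.eq_iff]
  grind

/-- A graph with more than `(q - 1) |S|` edges has a `q`-core. -/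
theorem edgesHaveCore_of_card {q : ℕ} (S : Finset V) :
    ∀ E : Finset (Sym2 V), E ⊆ pairs S → (q - 1) * S.card < E.card → EdgesHaveCore q E := by
  induction h : S.card generalizing S with
  | zero =>
    intro E hE hc
    have h1 := Finset.card_le_card hE
    rw [card_pairs, h] at h1
    simp at h1
    simp [h1] at hc
  | succ n ih =>
    intro E hE hc
    by_cases hd : ∀ v ∈ S, q ≤ (S.filter fun w => w ≠ v ∧ s(v, w) ∈ E).card
    · exact ⟨S, Finset.card_pos.1 (by omega), hd⟩
    push Not at hd
    obtain ⟨v, hv, hlt⟩ := hd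
    have hcard : (S.erase v).card = n := by rw [Finset.card_erase_of_mem hv, h]; rfl
    refine (ih (S.erase v) hcard (E ∩ pairs (S.erase v)) Finset.inter_subset_right ?_).mono
      Finset.inter_subset_left
    -- Deleting a vertex of degree below `q` loses at most `q - 1` edges, exactly the drop in the
    -- threshold.
    have hsub : E \ pairs (S.erase v) ⊆
        (S.filter fun w => w ≠ v ∧ s(v, w) ∈ E).image fun w => s(v, w) := by
      intro e he
      rw [Finset.mem_sdiff] at he
      obtain ⟨he, hne⟩ := he
      have heS := hE he
      induction e with | _ a b =>
      rw [mk_mem_pairs] at heS hne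
      simp only [Finset.mem_erase, Finset.mem_image, Finset.mem_filter] at hne ⊢
      by_cases ha : a = v
      · subst ha; exact ⟨b, ⟨heS.2.1, heS.2.2.symm, he⟩, rfl⟩
      · have hb : b = v := by grind
        subst hb
        exact ⟨a, ⟨heS.1, ha, by rwa [Sym2.eq_swap]⟩, Sym2.eq_swap⟩
    have h2 := (Finset.card_le_card hsub).trans Finset.card_image_le
    have h3 := Finset.card_sdiff_add_card_inter E (pairs (S.erase v))
    have h4 : (q - 1) * (n + 1) = (q - 1) * n + (q - 1) := by ring
    omega

end EdgeSets

/-! ### First and second moments of the isolated and pendant vertex counts -/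

section Statistics

variable {V : Type*} [DecidableEq V]

theorem filter_subset_powersetCard {α : Type*} [DecidableEq α] {A B : Finset α} (h : A ⊆ B)
    (m : ℕ) : (B.powersetCard m).filter (· ⊆ A) = A.powersetCard m := by
  ext E
  simp only [Finset.mem_filter, Finset.mem_powersetCard]
  exact ⟨fun ⟨h₁, h₂⟩ => ⟨h₂, h₁.2⟩, fun ⟨h₁, h₂⟩ => ⟨⟨h₁.trans h, h₂⟩, h₁⟩⟩

/-- The indicator that the vertex `v` is isolated in the graph on `S` with edge set `E`. -/
noncomputable def isolatedInd (S : Finset V) (E : Finset (Sym2 V)) (v : V) : ℝ :=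
  if E ⊆ pairs (S.erase v) then 1 else 0

/-- The number of isolated vertices in the graph on `S` with edge set `E`. -/
noncomputable def isolatedCount (S : Finset V) (E : Finset (Sym2 V)) : ℝ :=
  ∑ v ∈ S, isolatedInd S E v

/-- The indicator that `v` has degree one, with neighbour `w`, in the graph on `S` with
edge set `E`. -/
noncomputable def pendantInd (S : Finset V) (E : Finset (Sym2 V)) (v w : V) : ℝ :=
  if s(v, w) ∈ E ∧ E.erase s(v, w) ⊆ pairs (S.erase v) then 1 else 0

/-- The number of vertices of degree one in the graph on `S` with edge set `E`. -/
noncomputable def pendantCount (S : Finset V) (E : Finset (Sym2 V)) : ℝ :=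
  ∑ v ∈ S, ∑ w ∈ S.erase v, pendantInd S E v w

/-- Conditioned on `v` being isolated, the graph is uniform on the remaining vertices. -/
theorem sum_mul_isolatedInd {S : Finset V} (v : V) (m : ℕ)
    (g : Finset (Sym2 V) → ℝ) :
    ∑ E ∈ (pairs S).powersetCard m, g E * isolatedInd S E v =
      ∑ E ∈ (pairs (S.erase v)).powersetCard m, g E := by
  rw [← filter_subset_powersetCard (pairs_mono (S.erase_subset v)), Finset.sum_filter]
  simp [isolatedInd]

theorem sum_mul_isolatedCount {S : Finset V} (m : ℕ) (g : Finset (Sym2 V) → ℝ) :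
    ∑ E ∈ (pairs S).powersetCard m, g E * isolatedCount S E =
      ∑ v ∈ S, ∑ E ∈ (pairs (S.erase v)).powersetCard m, g E := by
  simp_rw [isolatedCount, Finset.mul_sum]
  rw [Finset.sum_comm]
  exact Finset.sum_congr rfl fun v _ => sum_mul_isolatedInd v m g

theorem sum_isolatedCount {n : ℕ} {S : Finset V} (hS : S.card = n + 1) (m : ℕ) :
    ∑ E ∈ (pairs S).powersetCard m, isolatedCount S E =
      (n + 1) * ((n.choose 2).choose m : ℝ) := by
  have h := sum_mul_isolatedCount (S := S) m fun _ => 1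
  simp only [one_mul] at h
  rw [h, Finset.sum_congr rfl (g := fun _ => ((n.choose 2).choose m : ℝ))]
  · simp [hS]
  · intro v hv
    simp [card_pairs, Finset.card_erase_of_mem hv, hS]

/-- Taking the count itself as the weight in `sum_mul_isolatedCount` removes one vertex `v` and
leaves a first moment: the term of `v` is `1`, and each other vertex removes a second one. -/
theorem sum_isolatedCount_sq {n : ℕ} {S : Finset V} (hS : S.card = n + 1) (m : ℕ) :
    ∑ E ∈ (pairs S).powersetCard m, isolatedCount S E ^ 2 =
      (n + 1) * ((n.choose 2).choose m : ℝ) + (n + 1) * n * (((n - 1).choose 2).choose m : ℝ) := by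
  simp_rw [sq]
  rw [sum_mul_isolatedCount]
  have hone : ∀ v ∈ S, ∑ E ∈ (pairs (S.erase v)).powersetCard m, isolatedCount S E =
      ((n.choose 2).choose m : ℝ) + n * (((n - 1).choose 2).choose m : ℝ) := by
    intro v hv
    have hcv : (S.erase v).card = n := by rw [Finset.card_erase_of_mem hv, hS]; rfl
    simp_rw [isolatedCount, ← Finset.add_sum_erase S _ hv]
    rw [Finset.sum_add_distrib]
    congr 1
    · rw [Finset.sum_congr rfl (g := fun _ => (1 : ℝ))]
      · simp [card_pairs, hcv]
      · intro E hE
        exact if_pos (Finset.mem_powersetCard.1 hE).1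
    · rw [Finset.sum_comm, Finset.sum_congr rfl
        (g := fun _ => (((n - 1).choose 2).choose m : ℝ))]
      · simp [hcv]
      · intro u hu
        have hcu : ((S.erase v).erase u).card = n - 1 := by
          rw [Finset.card_erase_of_mem hu, hcv]
        rw [← hcu, ← card_pairs, ← Finset.card_powersetCard, Finset.card_eq_sum_ones,
          Nat.cast_sum, ← filter_subset_powersetCard (pairs_mono ((S.erase v).erase_subset u)),
          Finset.sum_filter]
        refine Finset.sum_congr rfl fun E hE => ?_
        have hEv := (Finset.mem_powersetCard.1 hE).1
        have hiff : E ⊆ pairs (S.erase u) ↔ E ⊆ pairs ((S.erase v).erase u) := by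
          constructor
          · intro h
            have h2 := Finset.subset_inter hEv h
            rw [← pairs_inter] at h2
            refine h2.trans (pairs_mono ?_)
            intro x; simp only [Finset.mem_inter, Finset.mem_erase]; tauto
          · intro h
            refine h.trans (pairs_mono ?_)
            intro x; simp only [Finset.mem_erase]; tauto
        simp only [isolatedInd, hiff, Nat.cast_one]
  rw [Finset.sum_congr rfl hone, Finset.sum_const, hS, nsmul_eq_mul]
  push_cast
  ring

/-- Erasing the pendant edge is a bijection onto the sets of `m` edges avoiding `v`. -/
theorem sum_mul_pendantInd {S : Finset V} {v w : V} (hv : v ∈ S) (hw : w ∈ S.erase v) (m : ℕ)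
    (g : Finset (Sym2 V) → ℝ) :
    ∑ E ∈ (pairs S).powersetCard (m + 1), g E * pendantInd S E v w =
      ∑ E ∈ (pairs (S.erase v)).powersetCard m, g (insert s(v, w) E) := by
  simp only [pendantInd, mul_ite, mul_one, mul_zero]
  rw [← Finset.sum_filter]
  have hvw : s(v, w) ∈ pairs S := by
    rw [mk_mem_pairs]; simp only [Finset.mem_erase] at hw; exact ⟨hv, hw.2, hw.1.symm⟩
  have hnot : ∀ E ⊆ pairs (S.erase v), s(v, w) ∉ E := by
    intro E hE hmem
    have := mk_mem_pairs.1 (hE hmem)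
    simp at this
  refine Finset.sum_nbij' (fun E => E.erase s(v, w)) (fun E => insert s(v, w) E) ?_ ?_ ?_ ?_ ?_
  · intro E hE
    simp only [Finset.mem_filter, Finset.mem_powersetCard] at hE ⊢
    refine ⟨hE.2.2, ?_⟩
    rw [Finset.card_erase_of_mem hE.2.1, hE.1.2]; rfl
  · intro E hE
    simp only [Finset.mem_filter, Finset.mem_powersetCard] at hE ⊢
    have hn := hnot E hE.1
    refine ⟨⟨Finset.insert_subset hvw (hE.1.trans (pairs_mono (S.erase_subset v))), ?_⟩,
      Finset.mem_insert_self _ _, ?_⟩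
    · rw [Finset.card_insert_of_notMem hn, hE.2]
    · rw [Finset.erase_insert hn]; exact hE.1
  · intro E hE
    simp only [Finset.mem_filter] at hE
    exact Finset.insert_erase hE.2.1
  · intro E hE
    exact Finset.erase_insert (hnot E (Finset.mem_powersetCard.1 hE).1)
  · intro E hE
    simp only [Finset.mem_filter] at hE
    rw [Finset.insert_erase hE.2.1]

theorem sum_mul_pendantCount {S : Finset V} (m : ℕ) (g : Finset (Sym2 V) → ℝ) :
    ∑ E ∈ (pairs S).powersetCard (m + 1), g E * pendantCount S E =
      ∑ v ∈ S, ∑ w ∈ S.erase v,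
        ∑ E ∈ (pairs (S.erase v)).powersetCard m, g (insert s(v, w) E) := by
  simp_rw [pendantCount, Finset.mul_sum]
  rw [Finset.sum_comm]
  refine Finset.sum_congr rfl fun v hv => ?_
  rw [Finset.sum_comm]
  exact Finset.sum_congr rfl fun w hw => sum_mul_pendantInd hv hw m g

theorem sum_pendantCount {n : ℕ} {S : Finset V} (hS : S.card = n + 1) (m : ℕ) :
    ∑ E ∈ (pairs S).powersetCard (m + 1), pendantCount S E =
      (n + 1) * n * ((n.choose 2).choose m : ℝ) := by
  have h := sum_mul_pendantCount (S := S) m fun _ => 1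
  simp only [one_mul] at h
  rw [h, Finset.sum_congr rfl (g := fun _ => n * ((n.choose 2).choose m : ℝ))]
  · simp [hS]; ring
  · intro v hv
    simp [card_pairs, Finset.card_erase_of_mem hv, hS]

theorem sum_pendantInd_le_one (S : Finset V) (E : Finset (Sym2 V)) (v : V) (T : Finset V) :
    ∑ w ∈ T, pendantInd S E v w ≤ 1 := by
  by_cases h : ∃ w ∈ T, pendantInd S E v w ≠ 0
  · obtain ⟨w, hw, hne⟩ := h
    rw [Finset.sum_eq_single_of_mem w hw]
    · unfold pendantInd; split_ifs <;> norm_num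
    · intro x _ hxw
      have h1 : s(v, w) ∈ E ∧ E.erase s(v, w) ⊆ pairs (S.erase v) := by
        by_contra hc; exact hne (if_neg hc)
      refine if_neg fun h2 => ?_
      have h3 : s(v, x) ∈ E.erase s(v, w) := by
        refine Finset.mem_erase.2 ⟨fun h => hxw ?_, h2.1⟩
        rw [Sym2.eq_iff] at h; grind
      have := mk_mem_pairs.1 (h1.2 h3)
      simp at this
  · push Not at h
    rw [Finset.sum_eq_zero h]; norm_num

/-- The `2` pays for `v` itself and for `w`, which has degree one when `s(v, w)` is an isolated
edge. Any other pendant vertex cannot hang on `v`, whose only neighbour is `w`. -/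
theorem pendantInd_mul_pendantCount_le {S : Finset V} {E : Finset (Sym2 V)} {v w : V}
    (hv : v ∈ S) (hw : w ∈ S.erase v) :
    pendantInd S E v w * pendantCount S E ≤ 2 * pendantInd S E v w +
      ∑ v' ∈ (S.erase v).erase w, ∑ w' ∈ (S.erase v).erase v',
        pendantInd S E v w * pendantInd S E v' w' := by
  by_cases h : s(v, w) ∈ E ∧ E.erase s(v, w) ⊆ pairs (S.erase v)
  · have h1 : pendantInd S E v w = 1 := if_pos h
    rw [h1]
    simp only [one_mul, pendantCount]
    rw [← Finset.add_sum_erase S (fun v => ∑ w ∈ S.erase v, pendantInd S E v w) hv,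
      ← Finset.add_sum_erase (S.erase v) (fun v => ∑ w ∈ S.erase v, pendantInd S E v w) hw]
    have a1 := sum_pendantInd_le_one S E v (S.erase v)
    have a2 := sum_pendantInd_le_one S E w (S.erase w)
    have a3 : ∑ v' ∈ (S.erase v).erase w, ∑ w' ∈ S.erase v', pendantInd S E v' w' =
        ∑ v' ∈ (S.erase v).erase w, ∑ w' ∈ (S.erase v).erase v', pendantInd S E v' w' := by
      refine Finset.sum_congr rfl fun v' hv' => ?_
      simp only [Finset.mem_erase] at hv'
      rw [← Finset.add_sum_erase (S.erase v') _ (Finset.mem_erase.2 ⟨fun h => hv'.2.1 h.symm, hv⟩),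
        Finset.erase_right_comm]
      rw [add_eq_right]
      refine if_neg fun h2 => ?_
      have h3 : s(v', v) ∈ E.erase s(v, w) := by
        refine Finset.mem_erase.2 ⟨fun h => ?_, h2.1⟩
        rw [Sym2.eq_iff] at h; grind
      have := mk_mem_pairs.1 (h.2 h3)
      simp at this
    linarith
  · have h1 : pendantInd S E v w = 0 := if_neg h
    simp [h1]

/-- The two pendant edges are distinct and can be stripped one after the other, leaving `m - 1`
edges on `n - 1` vertices. -/
theorem sum_pendantInd_mul_pendantInd_le {n : ℕ} {S : Finset V} (hS : S.card = n + 1)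
    {v w v' w' : V} (hv : v ∈ S) (hw : w ∈ S.erase v) (hv' : v' ∈ (S.erase v).erase w)
    (hw' : w' ∈ (S.erase v).erase v') (m : ℕ) :
    ∑ E ∈ (pairs S).powersetCard (m + 1), pendantInd S E v w * pendantInd S E v' w' ≤
      (((n - 1).choose 2).choose (m - 1) : ℝ) := by
  have hcv : (S.erase v).card = n := by rw [Finset.card_erase_of_mem hv, hS]; rfl
  have hv'2 := Finset.mem_of_mem_erase hv'
  have hcu : ((S.erase v).erase v').card = n - 1 := by
    rw [Finset.card_erase_of_mem hv'2, hcv]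
  simp_rw [mul_comm (pendantInd S _ v w)]
  rw [sum_mul_pendantInd hv hw m fun E => pendantInd S E v' w']
  have hle : ∀ E ∈ (pairs (S.erase v)).powersetCard m,
      pendantInd S (insert s(v, w) E) v' w' ≤ pendantInd (S.erase v) E v' w' := by
    intro E hE
    have hEs := (Finset.mem_powersetCard.1 hE).1
    unfold pendantInd
    split_ifs with h₁ h₂
    · norm_num
    · exfalso
      apply h₂
      simp only [Finset.mem_erase] at hv' hw' hw
      have hne : s(v', w') ≠ s(v, w) := by
        intro h; rw [Sym2.eq_iff] at h; grind
      refine ⟨(Finset.mem_insert.1 h₁.1).resolve_left hne, fun e he => ?_⟩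
      have h3 := h₁.2 (Finset.erase_subset_erase _ (Finset.subset_insert _ _) he)
      have h4 := hEs (Finset.mem_of_mem_erase he)
      have h5 := Finset.mem_inter.2 ⟨h4, h3⟩
      rw [← pairs_inter] at h5
      refine pairs_mono ?_ h5
      intro x; simp only [Finset.mem_inter, Finset.mem_erase]; tauto
    · norm_num
    · norm_num
  refine (Finset.sum_le_sum hle).trans ?_
  cases m with
  -- With no edge left the sum vanishes, so the truncated `m - 1 = 0` on the right is harmless.
  | zero =>
    rw [Finset.powersetCard_zero, Finset.sum_singleton]
    simp [pendantInd]
  | succ k =>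
    have h := sum_mul_pendantInd hv'2 hw' k fun _ => (1 : ℝ)
    simp only [one_mul] at h
    rw [h]
    simp [card_pairs, hcu]

theorem sum_pendantCount_sq_le {n : ℕ} {S : Finset V} (hS : S.card = n + 1) (m : ℕ) :
    ∑ E ∈ (pairs S).powersetCard (m + 1), pendantCount S E ^ 2 ≤
      2 * ((n + 1) * n * ((n.choose 2).choose m : ℝ)) +
        (n + 1) * n * (n - 1 : ℕ) ^ 2 * (((n - 1).choose 2).choose (m - 1) : ℝ) := by
  have hpt : ∀ E, pendantCount S E ^ 2 ≤ 2 * pendantCount S E +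
      ∑ v ∈ S, ∑ w ∈ S.erase v, ∑ v' ∈ (S.erase v).erase w, ∑ w' ∈ (S.erase v).erase v',
        pendantInd S E v w * pendantInd S E v' w' := by
    intro E
    have h1 : pendantCount S E ^ 2 =
        ∑ v ∈ S, ∑ w ∈ S.erase v, pendantInd S E v w * pendantCount S E := by
      rw [sq]; nth_rewrite 1 [pendantCount]; simp_rw [Finset.sum_mul]
    rw [h1]
    nth_rewrite 2 [pendantCount]
    simp_rw [Finset.mul_sum, ← Finset.sum_add_distrib]
    refine Finset.sum_le_sum fun v hv => Finset.sum_le_sum fun w hw => ?_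
    have := pendantInd_mul_pendantCount_le (E := E) hv hw
    simpa [Finset.mul_sum] using this
  refine (Finset.sum_le_sum fun E _ => hpt E).trans ?_
  rw [Finset.sum_add_distrib, ← Finset.mul_sum, sum_pendantCount hS]
  refine add_le_add le_rfl ?_
  rw [Finset.sum_comm]
  have hin : ∀ v ∈ S, ∑ E ∈ (pairs S).powersetCard (m + 1), ∑ w ∈ S.erase v,
      ∑ v' ∈ (S.erase v).erase w, ∑ w' ∈ (S.erase v).erase v',
        pendantInd S E v w * pendantInd S E v' w' ≤
      n * ((n - 1 : ℕ) * ((n - 1 : ℕ) * (((n - 1).choose 2).choose (m - 1) : ℝ))) := by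
    intro v hv
    have hcv : (S.erase v).card = n := by rw [Finset.card_erase_of_mem hv, hS]; rfl
    rw [Finset.sum_comm]
    refine (Finset.sum_le_card_nsmul _ _ _ fun w hw => ?_).trans_eq (by rw [hcv, nsmul_eq_mul])
    have hcw : ((S.erase v).erase w).card = n - 1 := by rw [Finset.card_erase_of_mem hw, hcv]
    rw [Finset.sum_comm]
    refine (Finset.sum_le_card_nsmul _ _ _ fun v' hv' => ?_).trans_eq (by rw [hcw, nsmul_eq_mul])
    have hcu : ((S.erase v).erase v').card = n - 1 := by
      rw [Finset.card_erase_of_mem (Finset.mem_of_mem_erase hv'), hcv]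
    rw [Finset.sum_comm]
    refine (Finset.sum_le_card_nsmul _ _ _ fun w' hw' => ?_).trans_eq (by rw [hcu, nsmul_eq_mul])
    exact sum_pendantInd_mul_pendantInd_le hS hv hw hv' hw' m
  refine (Finset.sum_le_card_nsmul _ _ _ hin).trans_eq ?_
  rw [hS, nsmul_eq_mul]
  push_cast
  ring

theorem sum_coreInd_mul_isolatedCount {q n : ℕ} (hq : 1 ≤ q) {S : Finset V}
    (hS : S.card = n + 1) (m : ℕ) :
    ∑ E ∈ (pairs S).powersetCard m, coreInd q E * isolatedCount S E =
      (n + 1) * coreCount q (Finset.univ : Finset (Fin n)) m := by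
  rw [sum_mul_isolatedCount, Finset.sum_congr rfl
    (g := fun _ => coreCount q (Finset.univ : Finset (Fin n)) m)]
  · simp [hS]
  · intro v hv
    have hcv : (S.erase v).card = n := by rw [Finset.card_erase_of_mem hv, hS]; rfl
    rw [← hcv, ← coreCount_eq_card hq, coreCount]

/-- This links `m + 1` edges on `n + 1` vertices to `m` edges on `n`: the stripped pendant edge is
irrelevant to the core. -/
theorem sum_coreInd_mul_pendantCount {q n : ℕ} (hq : 2 ≤ q) {S : Finset V}
    (hS : S.card = n + 1) (m : ℕ) :
    ∑ E ∈ (pairs S).powersetCard (m + 1), coreInd q E * pendantCount S E =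
      (n + 1) * n * coreCount q (Finset.univ : Finset (Fin n)) m := by
  rw [sum_mul_pendantCount, Finset.sum_congr rfl
    (g := fun _ => n * coreCount q (Finset.univ : Finset (Fin n)) m)]
  · simp [hS]; ring
  · intro v hv
    have hcv : (S.erase v).card = n := by rw [Finset.card_erase_of_mem hv, hS]; rfl
    rw [Finset.sum_congr rfl (g := fun _ => coreCount q (Finset.univ : Finset (Fin n)) m)]
    · simp [hcv]
    · intro w _
      rw [← hcv, ← coreCount_eq_card (by omega), coreCount]
      refine Finset.sum_congr rfl fun E hE => coreInd_congr ?_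
      exact edgesHaveCore_insert_pendant hq (Finset.mem_powersetCard.1 hE).1

end Statistics

/-! ### The effect of one edge in the linear regime -/

section Increments

/-- The proportion of graphs with `n` vertices and `m` edges that have a `q`-core. -/
noncomputable def coreProb (q n m : ℕ) : ℝ :=
  coreCount q (Finset.univ : Finset (Fin n)) m / ((n.choose 2).choose m : ℝ)

theorem coreProb_nonneg (q n m : ℕ) : 0 ≤ coreProb q n m :=
  div_nonneg (coreCount_nonneg _ _ _) (Nat.cast_nonneg _)

theorem coreProb_le_one (q n m : ℕ) : coreProb q n m ≤ 1 := by
  refine div_le_one_of_le₀ ?_ (Nat.cast_nonneg _)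
  simpa using coreCount_le q (Finset.univ : Finset (Fin n)) m

theorem coreCount_eq_coreProb_mul {q n m : ℕ} (hm : m ≤ n.choose 2) :
    coreCount q (Finset.univ : Finset (Fin n)) m =
      coreProb q n m * ((n.choose 2).choose m : ℝ) := by
  have : ((n.choose 2).choose m : ℝ) ≠ 0 := by
    exact_mod_cast (Nat.choose_pos hm).ne'
  rw [coreProb, div_mul_cancel₀ _ this]

/-- Covariance bound: if `X` has mean `μ` and variance at most `μ ^ 2 * v`, then the
`X`-weighted sum of `f` is close to `μ` times the sum of `f`. -/
theorem abs_sum_mul_sub_le {ι : Type*} (Ω : Finset ι) (f X : ι → ℝ) {μ v T : ℝ}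
    (hf : ∀ i ∈ Ω, f i ^ 2 ≤ 1) (hT : (Ω.card : ℝ) = T) (hμ : 0 ≤ μ)
    (hsum : ∑ i ∈ Ω, X i = μ * T) (hsq : ∑ i ∈ Ω, X i ^ 2 ≤ μ ^ 2 * (1 + v) * T) :
    |∑ i ∈ Ω, f i * X i - μ * ∑ i ∈ Ω, f i| ≤ T * μ * √v := by
  have hT0 : 0 ≤ T := hT ▸ Nat.cast_nonneg _
  have h1 : ∑ i ∈ Ω, f i * X i - μ * ∑ i ∈ Ω, f i = ∑ i ∈ Ω, f i * (X i - μ) := by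
    rw [Finset.mul_sum, ← Finset.sum_sub_distrib]
    exact Finset.sum_congr rfl fun i _ => by ring
  have h2 : ∑ i ∈ Ω, (X i - μ) ^ 2 ≤ μ ^ 2 * v * T := by
    have : ∑ i ∈ Ω, (X i - μ) ^ 2 = ∑ i ∈ Ω, X i ^ 2 - 2 * μ * ∑ i ∈ Ω, X i + T * μ ^ 2 := by
      rw [Finset.mul_sum, ← Finset.sum_sub_distrib, ← hT, ← nsmul_eq_mul, ← Finset.sum_const,
        ← Finset.sum_add_distrib]
      exact Finset.sum_congr rfl fun i _ => by ring
    rw [this, hsum]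
    linarith
  have h3 : ∑ i ∈ Ω, f i ^ 2 ≤ T := by
    refine (Finset.sum_le_sum hf).trans ?_
    simp [hT]
  have h4 := Finset.sum_mul_sq_le_sq_mul_sq Ω f fun i => X i - μ
  have h5 : (∑ i ∈ Ω, f i * (X i - μ)) ^ 2 ≤ (T * μ) ^ 2 * v := by
    refine h4.trans ((mul_le_mul h3 h2 (Finset.sum_nonneg fun _ _ => sq_nonneg _) hT0).trans_eq ?_)
    ring
  rw [h1]
  refine (Real.abs_le_sqrt h5).trans_eq ?_
  rw [Real.sqrt_mul (sq_nonneg _), Real.sqrt_sq (by positivity)]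

theorem choose_two_succ (n : ℕ) : (n + 1).choose 2 = n.choose 2 + n := by
  rw [Nat.choose_succ_succ' n 1, Nat.choose_one_right, add_comm]

/-- Factor by factor: `x (x + 2k + 1) ≤ (x + k) ^ 2` amounts to `x ≤ k ^ 2`. The shifts are those
from `k.choose 2` to the next two binomials. -/
theorem descFactorial_mul_descFactorial_le {A k : ℕ} (h : A ≤ k ^ 2) (m : ℕ) :
    A.descFactorial m * (A + (2 * k + 1)).descFactorial m ≤ (A + k).descFactorial m ^ 2 := by
  induction m with
  | zero => simp
  | succ m ih =>
    simp only [Nat.descFactorial_succ]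
    have h1 : (A - m) * (A + (2 * k + 1) - m) ≤ (A + k - m) ^ 2 := by
      rcases le_or_gt A m with hm | hm
      · rw [Nat.sub_eq_zero_of_le hm]; simp
      · obtain ⟨x, rfl⟩ := Nat.exists_eq_add_of_lt hm
        have e1 : m + x + 1 - m = x + 1 := by omega
        have e2 : m + x + 1 + (2 * k + 1) - m = x + 1 + (2 * k + 1) := by omega
        have e3 : m + x + 1 + k - m = x + 1 + k := by omega
        rw [e1, e2, e3]
        nlinarith
    calc _ = ((A - m) * (A + (2 * k + 1) - m)) *
          (A.descFactorial m * (A + (2 * k + 1)).descFactorial m) := by ring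
      _ ≤ (A + k - m) ^ 2 * (A + k).descFactorial m ^ 2 := Nat.mul_le_mul h1 ih
      _ = _ := by ring

/-- Distinct vertices being isolated are negatively correlated events. -/
theorem choose_mul_choose_le_sq (n m : ℕ) :
    ((n - 1).choose 2).choose m * ((n + 1).choose 2).choose m ≤ ((n.choose 2).choose m) ^ 2 := by
  cases n with
  | zero =>
    cases m <;> simp
  | succ k =>
    have hA : k.choose 2 ≤ k ^ 2 := by
      rw [Nat.choose_two_right]
      exact (Nat.div_le_self _ _).trans (by rw [sq]; exact Nat.mul_le_mul_left _ (Nat.sub_le _ _))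
    have h := descFactorial_mul_descFactorial_le hA m
    have e : (k + 1 + 1).choose 2 = k.choose 2 + (2 * k + 1) := by
      rw [choose_two_succ, choose_two_succ]; ring
    rw [e, choose_two_succ, Nat.add_sub_cancel]
    simp only [Nat.descFactorial_eq_factorial_mul_choose] at h
    have hp : 0 < m.factorial ^ 2 := by positivity
    refine Nat.le_of_mul_le_mul_left ?_ hp
    calc _ = (m.factorial * (k.choose 2).choose m) *
          (m.factorial * (k.choose 2 + (2 * k + 1)).choose m) := by ring
      _ ≤ _ := h
      _ = _ := by ring

/-- Under the root stands `1 / μ`, with `μ` the mean number of isolated vertices; by negative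
correlation the variance is at most `μ`. -/
theorem abs_coreProb_sub_isolated {q n m : ℕ} (hq : 1 ≤ q) (hm : m ≤ n.choose 2) :
    |coreProb q n m - coreProb q (n + 1) m| ≤
      √(((n + 1) * ((n.choose 2).choose m / ((n + 1).choose 2).choose m) : ℝ)⁻¹) := by
  have hm' : m ≤ (n + 1).choose 2 := hm.trans (by rw [choose_two_succ]; omega)
  set T : ℝ := ((((n + 1).choose 2).choose m : ℕ) : ℝ) with hTdef
  have hT : 0 < T := by
    rw [hTdef]; exact_mod_cast Nat.choose_pos hm'
  set B : ℝ := (((n.choose 2).choose m : ℕ) : ℝ) with hBdef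
  have hB : 0 < B := by
    rw [hBdef]; exact_mod_cast Nat.choose_pos hm
  set μ : ℝ := (n + 1) * (B / T) with hμdef
  have hμ : 0 < μ := by positivity
  have hμT : μ * T = (n + 1) * B := by rw [hμdef]; field_simp
  have hS : (Finset.univ : Finset (Fin (n + 1))).card = n + 1 := by simp
  have key := abs_sum_mul_sub_le ((pairs (Finset.univ : Finset (Fin (n + 1)))).powersetCard m)
    (coreInd q) (isolatedCount Finset.univ) (μ := μ) (v := μ⁻¹) (T := T)
    (fun E _ => by rw [coreInd_sq]; exact coreInd_le_one q E)
    (by rw [Finset.card_powersetCard, card_pairs, hS])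
    hμ.le
    (by rw [sum_isolatedCount hS, hμT])
    (by
      rw [sum_isolatedCount_sq hS]
      have h1 : (((n - 1).choose 2).choose m : ℝ) * T ≤ B ^ 2 := by
        rw [hTdef, hBdef]; exact_mod_cast choose_mul_choose_le_sq n m
      have h2 : μ ^ 2 * (1 + μ⁻¹) * T = (n + 1) * B + μ ^ 2 * T := by
        rw [← hμT]; field_simp; ring
      rw [h2, add_le_add_iff_left]
      refine le_of_mul_le_mul_right ?_ hT
      calc ((n : ℝ) + 1) * n * (((n - 1).choose 2).choose m : ℝ) * T
          = ((n : ℝ) + 1) * n * ((((n - 1).choose 2).choose m : ℝ) * T) := by ring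
        _ ≤ ((n : ℝ) + 1) * (n + 1) * B ^ 2 := by gcongr; linarith
        _ = (μ * T) ^ 2 := by rw [hμT]; ring
        _ = μ ^ 2 * T * T := by ring)
  rw [sum_coreInd_mul_isolatedCount hq hS, ← coreCount, coreCount_eq_coreProb_mul hm,
    coreCount_eq_coreProb_mul hm', ← hTdef, ← hBdef] at key
  have h3 : ((n : ℝ) + 1) * (coreProb q n m * B) - μ * (coreProb q (n + 1) m * T) =
      (T * μ) * (coreProb q n m - coreProb q (n + 1) m) := by
    linear_combination (-coreProb q n m) * hμT
  rw [h3, abs_mul, abs_of_pos (by positivity)] at key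
  exact le_of_mul_le_mul_left key (by positivity)

/-- Both outer binomials are moved to lower index `m`, where `choose_mul_choose_le_sq` applies. The
two moves cost the displayed ratio times `m / (m + 1)`, which is dropped. -/
theorem choose_mul_choose_le_sq_mul {n m : ℕ} (hm1 : 1 ≤ m) (hm : m ≤ (n - 1).choose 2) :
    (((n - 1).choose 2).choose (m - 1) : ℝ) * ((n + 1).choose 2).choose (m + 1) ≤
      ((n.choose 2).choose m : ℝ) ^ 2 *
        (((n + 1).choose 2 - m : ℝ) / ((n - 1).choose 2 - m + 1)) := by
  obtain ⟨k, rfl⟩ : ∃ k, m = k + 1 := ⟨m - 1, by omega⟩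
  rw [Nat.add_sub_cancel]
  have h0 : (((n - 1).choose 2).choose (k + 1) : ℝ) * ((n + 1).choose 2).choose (k + 1) ≤
      ((n.choose 2).choose (k + 1) : ℝ) ^ 2 := by exact_mod_cast choose_mul_choose_le_sq n (k + 1)
  have hN : k + 1 ≤ (n + 1).choose 2 := hm.trans (Nat.choose_le_choose 2 (by omega))
  have h1 : (((n - 1).choose 2).choose (k + 1) : ℝ) * (k + 1) =
      ((n - 1).choose 2).choose k * ((n - 1).choose 2 - k) := by
    have := Nat.choose_succ_right_eq ((n - 1).choose 2) k
    rw [← Nat.cast_sub (by omega)]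
    exact_mod_cast this
  have h2 : (((n + 1).choose 2).choose (k + 1 + 1) : ℝ) * (k + 1 + 1) =
      ((n + 1).choose 2).choose (k + 1) * ((n + 1).choose 2 - (k + 1)) := by
    have := Nat.choose_succ_right_eq ((n + 1).choose 2) (k + 1)
    have h := congrArg (Nat.cast (R := ℝ)) this
    rw [Nat.cast_mul, Nat.cast_mul, Nat.cast_sub hN] at h
    push_cast at h
    exact h
  have hN' : ((k : ℝ) + 1) ≤ (n + 1).choose 2 := by exact_mod_cast hN
  have hN'' : ((k : ℝ) + 1) ≤ (n - 1).choose 2 := by exact_mod_cast hm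
  set a : ℝ := (((n - 1).choose 2).choose k : ℝ)
  set b : ℝ := (((n + 1).choose 2).choose (k + 1 + 1) : ℝ)
  set c : ℝ := (((n - 1).choose 2).choose (k + 1) : ℝ)
  set d : ℝ := (((n + 1).choose 2).choose (k + 1) : ℝ)
  have hb : 0 ≤ b := Nat.cast_nonneg _
  have hc : 0 ≤ c := Nat.cast_nonneg _
  have hd : 0 ≤ d := Nat.cast_nonneg _
  push_cast
  rw [← mul_div_assoc, le_div_iff₀ (by linarith)]
  have hk : (0 : ℝ) < (k : ℝ) + 1 + 1 := by positivity
  refine le_of_mul_le_mul_right ?_ hk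
  calc a * b * ((n - 1).choose 2 - ((k : ℝ) + 1) + 1) * ((k : ℝ) + 1 + 1)
      = (a * ((n - 1).choose 2 - k)) * (b * ((k : ℝ) + 1 + 1)) := by ring
    _ = c * d * ((n + 1).choose 2 - ((k : ℝ) + 1)) * ((k : ℝ) + 1) := by rw [← h1, h2]; ring
    _ ≤ ((n.choose 2).choose (k + 1) : ℝ) ^ 2 * ((n + 1).choose 2 - ((k : ℝ) + 1)) *
        ((k : ℝ) + 1 + 1) := by
      have : (0 : ℝ) ≤ (n + 1).choose 2 - ((k : ℝ) + 1) := by linarith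
      gcongr
      linarith

/-- The relative variance of the pendant count has a diagonal part `2 / μ` and a part `κ - 1`
bounding the positive correlation of distinct pendant vertices. -/
theorem abs_coreProb_sub_pendant {q n m : ℕ} (hq : 2 ≤ q) (hn : 1 ≤ n) (hm1 : 1 ≤ m)
    (hm : m ≤ (n - 1).choose 2) :
    |coreProb q n m - coreProb q (n + 1) (m + 1)| ≤
      √(2 * ((n + 1) * n * ((n.choose 2).choose m / ((n + 1).choose 2).choose (m + 1)) : ℝ)⁻¹ +
        (((n + 1).choose 2 - m : ℝ) / ((n - 1).choose 2 - m + 1) - 1)) := by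
  have hm2 : m ≤ n.choose 2 := hm.trans (Nat.choose_le_choose 2 (by omega))
  have hm' : m + 1 ≤ (n + 1).choose 2 := by rw [choose_two_succ]; omega
  set T : ℝ := ((((n + 1).choose 2).choose (m + 1) : ℕ) : ℝ) with hTdef
  have hT : 0 < T := by
    rw [hTdef]; exact_mod_cast Nat.choose_pos hm'
  set B : ℝ := (((n.choose 2).choose m : ℕ) : ℝ) with hBdef
  have hB : 0 < B := by
    rw [hBdef]; exact_mod_cast Nat.choose_pos hm2
  have hn0 : (0 : ℝ) < n := by exact_mod_cast hn
  set κ : ℝ := ((n + 1).choose 2 - m : ℝ) / ((n - 1).choose 2 - m + 1) with hκ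
  set μ : ℝ := (n + 1) * n * (B / T) with hμdef
  have hμ : 0 < μ := by positivity
  have hμT : μ * T = (n + 1) * n * B := by rw [hμdef]; field_simp
  have hS : (Finset.univ : Finset (Fin (n + 1))).card = n + 1 := by simp
  have key := abs_sum_mul_sub_le
    ((pairs (Finset.univ : Finset (Fin (n + 1)))).powersetCard (m + 1))
    (coreInd q) (pendantCount Finset.univ) (μ := μ) (v := 2 * μ⁻¹ + (κ - 1)) (T := T)
    (fun E _ => by rw [coreInd_sq]; exact coreInd_le_one q E)
    (by rw [Finset.card_powersetCard, card_pairs, hS])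
    hμ.le
    (by rw [sum_pendantCount hS, hμT])
    (by
      refine (sum_pendantCount_sq_le hS m).trans ?_
      have h1 : (((n - 1).choose 2).choose (m - 1) : ℝ) * T ≤ B ^ 2 * κ :=
        choose_mul_choose_le_sq_mul hm1 hm
      have h2 : μ ^ 2 * (1 + (2 * μ⁻¹ + (κ - 1))) * T =
          2 * ((n + 1) * n * B) + μ ^ 2 * κ * T := by
        rw [← hμT]; field_simp; ring
      rw [h2, add_le_add_iff_left]
      refine le_of_mul_le_mul_right ?_ hT
      have hn1 : ((n - 1 : ℕ) : ℝ) ^ 2 ≤ (n + 1) * n := by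
        have : ((n - 1 : ℕ) : ℝ) ≤ n := by exact_mod_cast Nat.sub_le n 1
        nlinarith [Nat.cast_nonneg (α := ℝ) (n - 1)]
      have hpos : 0 ≤ (((n - 1).choose 2).choose (m - 1) : ℝ) * T := by positivity
      calc ((n : ℝ) + 1) * n * (n - 1 : ℕ) ^ 2 * (((n - 1).choose 2).choose (m - 1) : ℝ) * T
          = ((n : ℝ) + 1) * n * (n - 1 : ℕ) ^ 2 *
            ((((n - 1).choose 2).choose (m - 1) : ℝ) * T) := by ring
        _ ≤ ((n : ℝ) + 1) * n * ((n + 1) * n) * (B ^ 2 * κ) := by gcongr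
        _ = (μ * T) ^ 2 * κ := by rw [hμT]; ring
        _ = μ ^ 2 * κ * T * T := by ring)
  rw [sum_coreInd_mul_pendantCount hq hS, ← coreCount, coreCount_eq_coreProb_mul hm2,
    coreCount_eq_coreProb_mul hm', ← hTdef, ← hBdef] at key
  have h3 : ((n : ℝ) + 1) * n * (coreProb q n m * B) - μ * (coreProb q (n + 1) (m + 1) * T) =
      (T * μ) * (coreProb q n m - coreProb q (n + 1) (m + 1)) := by
    linear_combination (-coreProb q n m) * hμT
  rw [h3, abs_mul, abs_of_pos (by positivity)] at key
  exact le_of_mul_le_mul_left key (by positivity)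

/-- The hypothesis `h` says that every ratio `(A - i) / (A + n - i)` with `i ≤ m` is at least `1 -
y`. -/
theorem descFactorial_mul_pow_le {A n m : ℕ} (hm : m ≤ A) {y : ℝ} (hy : 0 ≤ y) (hy1 : y ≤ 1)
    (h : n ≤ y * (A + n - m)) :
    ((A + n).descFactorial m : ℝ) * (1 - y) ^ m ≤ A.descFactorial m := by
  have main : ∀ i ≤ m, ((A + n).descFactorial i : ℝ) * (1 - y) ^ i ≤ A.descFactorial i := by
    intro i
    induction i with
    | zero => simp
    | succ i ih =>
      intro hi
      have ih' := ih (by omega)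
      simp only [Nat.descFactorial_succ]
      push_cast [Nat.cast_sub (show i ≤ A + n by omega), Nat.cast_sub (show i ≤ A by omega)]
      have hiA : (i : ℝ) ≤ A := by exact_mod_cast (by omega : i ≤ A)
      have him : (i : ℝ) ≤ m := by exact_mod_cast (by omega : i ≤ m)
      have h1 : ((A : ℝ) + n - i) * (1 - y) ≤ A - i := by nlinarith
      calc ((A : ℝ) + n - i) * ((A + n).descFactorial i : ℝ) * (1 - y) ^ (i + 1)
          = (((A : ℝ) + n - i) * (1 - y)) * (((A + n).descFactorial i : ℝ) * (1 - y) ^ i) := by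
            ring
        _ ≤ (A - i) * A.descFactorial i := by
          refine mul_le_mul h1 ih' ?_ (by linarith)
          have : 0 ≤ 1 - y := by linarith
          positivity
  exact main m le_rfl

theorem exp_neg_two_mul_le {y : ℝ} (hy : 0 ≤ y) (hy1 : y ≤ 1 / 2) :
    Real.exp (-(2 * y)) ≤ 1 - y := by
  rw [Real.exp_neg, inv_le_comm₀ (Real.exp_pos _) (by linarith)]
  refine le_trans ?_ (Real.add_one_le_exp (2 * y))
  rw [inv_le_iff_one_le_mul₀ (by linarith)]
  nlinarith

/-- A given vertex of a sparse random graph is isolated with probability bounded below. -/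
theorem le_choose_div_choose {n m K : ℕ} (hn : 8 ≤ n) (hnK : 4 * K + 6 ≤ n) (hm : m ≤ K * n) :
    Real.exp (-(8 * K)) ≤
      ((n.choose 2).choose m / ((n + 1).choose 2).choose m : ℝ) := by
  have hn0 : (0 : ℝ) < n := by exact_mod_cast (by omega : 0 < n)
  have hnK' : (4 : ℝ) * K + 6 ≤ n := by exact_mod_cast hnK
  have hm' : (m : ℝ) ≤ K * n := by exact_mod_cast hm
  have hn8 : (8 : ℝ) ≤ n := by exact_mod_cast hn
  have hA : ((n.choose 2 : ℕ) : ℝ) = n * (n - 1) / 2 := Nat.cast_choose_two ℝ n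
  have hmA : m ≤ n.choose 2 := by
    have : (m : ℝ) ≤ (n.choose 2 : ℕ) := by rw [hA]; nlinarith
    exact_mod_cast this
  -- The choice `y = 4 / n` works since `n.choose 2 + n - m ≥ n ^ 2 / 4`; then `(1 - 4 / n) ^ m ≥
  -- exp (-8 m / n)`.
  have h := descFactorial_mul_pow_le (n := n) hmA (y := 4 / n) (by positivity)
    (by rw [div_le_one hn0]; linarith)
    (by
      rw [div_mul_eq_mul_div, le_div_iff₀ hn0, hA]
      nlinarith)
  rw [choose_two_succ, le_div_iff₀ (by exact_mod_cast Nat.choose_pos (by omega))]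
  rw [Nat.descFactorial_eq_factorial_mul_choose, Nat.descFactorial_eq_factorial_mul_choose] at h
  push_cast at h
  have hf : (0 : ℝ) < m.factorial := by exact_mod_cast m.factorial_pos
  have h2 : ((n.choose 2 + n).choose m : ℝ) * (1 - 4 / n) ^ m ≤ (n.choose 2).choose m := by
    refine le_of_mul_le_mul_left ?_ hf
    linarith
  refine le_trans ?_ h2
  rw [mul_comm]
  refine mul_le_mul_of_nonneg_left ?_ (Nat.cast_nonneg _)
  have h3 := exp_neg_two_mul_le (y := 4 / n) (by positivity)
    (by rw [div_le_iff₀ hn0]; linarith)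
  refine le_trans ?_ (pow_le_pow_left₀ (Real.exp_pos _).le h3 m)
  rw [← Real.exp_nat_mul, Real.exp_le_exp]
  have : (m : ℝ) * (4 / n) ≤ 4 * K := by
    rw [mul_div_assoc', div_le_iff₀ hn0]; linarith
  linarith

/-- In the linear regime an additional edge changes the probability of a `q`-core by
`O(n ^ (-1/2))`. -/
theorem coreProb_succ_sub_le_of_linear {q n m K : ℕ} {ε : ℝ} (hq : 2 ≤ q) (hε : 0 < ε)
    (hn : 8 ≤ n) (hnK : 4 * K + 6 ≤ n) (hm : m + 1 ≤ K * n) (hm1 : 1 ≤ m) (hεm : ε * n ≤ m + 1) :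
    coreProb q n (m + 1) - coreProb q n m ≤
      (√((Real.exp (-(8 * K)))⁻¹) + √((ε * Real.exp (-(8 * K)))⁻¹ + 8)) / √n := by
  have hn0 : (0 : ℝ) < n := by exact_mod_cast (by omega : 0 < n)
  have hnK' : (4 : ℝ) * K + 6 ≤ n := by exact_mod_cast hnK
  have hm' : (m : ℝ) + 1 ≤ K * n := by exact_mod_cast hm
  have hn8 : (8 : ℝ) ≤ n := by exact_mod_cast hn
  have hA : ((n.choose 2 : ℕ) : ℝ) = n * (n - 1) / 2 := Nat.cast_choose_two ℝ n
  have hA1 : (((n + 1).choose 2 : ℕ) : ℝ) = (n + 1) * n / 2 := by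
    rw [Nat.cast_choose_two]; push_cast; ring
  have hA2 : (((n - 1).choose 2 : ℕ) : ℝ) = (n - 1) * (n - 2) / 2 := by
    rw [Nat.cast_choose_two, Nat.cast_sub (by omega)]; push_cast; ring
  have hmA : m + 1 ≤ n.choose 2 := by
    have : (m : ℝ) + 1 ≤ (n.choose 2 : ℕ) := by rw [hA]; nlinarith
    exact_mod_cast this
  have hmA2 : m ≤ (n - 1).choose 2 := by
    have : (m : ℝ) ≤ ((n - 1).choose 2 : ℕ) := by rw [hA2]; nlinarith
    exact_mod_cast this
  set δ := Real.exp (-(8 * (K : ℝ))) with hδ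
  have hδ0 : 0 < δ := Real.exp_pos _
  have r1 : δ ≤ ((n.choose 2).choose (m + 1) / ((n + 1).choose 2).choose (m + 1) : ℝ) :=
    le_choose_div_choose hn hnK hm
  have r2 : δ ≤ ((n.choose 2).choose m / ((n + 1).choose 2).choose m : ℝ) :=
    le_choose_div_choose hn hnK (by omega)
  -- Both `(n, m + 1)` and `(n, m)` are compared with `(n + 1, m + 1)`.
  have d1 := abs_coreProb_sub_isolated (q := q) (by omega) hmA
  have d2 := abs_coreProb_sub_pendant (q := q) (n := n) hq (by omega) hm1 hmA2
  have b1 : √(((n + 1) * ((n.choose 2).choose (m + 1) /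
      ((n + 1).choose 2).choose (m + 1)) : ℝ)⁻¹) ≤ √(δ⁻¹) / √n := by
    rw [← Real.sqrt_div (by positivity)]
    refine Real.sqrt_le_sqrt ?_
    rw [show δ⁻¹ / n = (n * δ)⁻¹ by field_simp]
    refine inv_anti₀ (by positivity) ?_
    exact mul_le_mul (by linarith) r1 hδ0.le (by positivity)
  have b2 : √(2 * ((n + 1) * n * ((n.choose 2).choose m /
        ((n + 1).choose 2).choose (m + 1)) : ℝ)⁻¹ +
        (((n + 1).choose 2 - m : ℝ) / ((n - 1).choose 2 - m + 1) - 1)) ≤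
      √((ε * δ)⁻¹ + 8) / √n := by
    rw [← Real.sqrt_div (by positivity)]
    refine Real.sqrt_le_sqrt ?_
    rw [add_div]
    refine add_le_add ?_ ?_
    · have hN : m + 1 ≤ (n + 1).choose 2 := by rw [choose_two_succ]; omega
      have hN' : (m : ℝ) + 1 ≤ (n + 1).choose 2 := by exact_mod_cast hN
      have hc : (((n + 1).choose 2).choose (m + 1) : ℝ) * (m + 1) =
          ((n + 1).choose 2).choose m * ((n + 1).choose 2 - m) := by
        have := Nat.choose_succ_right_eq ((n + 1).choose 2) m
        rw [← Nat.cast_sub (by omega)]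
        exact_mod_cast this
      have hp1 : (0 : ℝ) < ((n + 1).choose 2).choose (m + 1) := by
        exact_mod_cast Nat.choose_pos hN
      have hp2 : (0 : ℝ) < ((n + 1).choose 2).choose m := by
        exact_mod_cast Nat.choose_pos (by omega)
      rw [le_div_iff₀ hp2] at r2
      -- The mean number of pendant vertices is at least `2 δ (m + 1)`, since passing from `m` to `m
      -- + 1` below gains the factor `(m + 1) / ((n + 1).choose 2 - m)`.
      have hμ : 2 * (ε * δ * n) ≤ ((n + 1) * n * ((n.choose 2).choose m /
          ((n + 1).choose 2).choose (m + 1)) : ℝ) := by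
        rw [mul_div_assoc', le_div_iff₀ hp1]
        have hm10 : (0 : ℝ) < (m : ℝ) + 1 := by positivity
        refine le_of_mul_le_mul_right ?_ hm10
        calc 2 * (ε * δ * n) * ((n + 1).choose 2).choose (m + 1) * ((m : ℝ) + 1)
            = 2 * (ε * n) * δ * (((n + 1).choose 2).choose (m + 1) * ((m : ℝ) + 1)) := by ring
          _ = 2 * (ε * n) * (δ * ((n + 1).choose 2).choose m) * ((n + 1).choose 2 - m) := by
            rw [hc]; ring
          _ ≤ 2 * (m + 1) * ((n.choose 2).choose m) * ((n + 1).choose 2) := by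
            have : (0 : ℝ) ≤ (n + 1).choose 2 - m := by linarith
            gcongr
            linarith [Nat.cast_nonneg (α := ℝ) m]
          _ = _ := by rw [hA1]; ring
      calc _ ≤ 2 * (2 * (ε * δ * n))⁻¹ := by gcongr
        _ = _ := by field_simp
    -- The correlation excess is `2n - 2` over this denominator, hence at most `8 / n`.
    · have hpos : (n : ℝ) ^ 2 / 4 ≤ (((n - 1).choose 2 : ℕ) : ℝ) - m + 1 := by
        rw [hA2]; nlinarith
      have hpos0 : 0 < (n : ℝ) ^ 2 / 4 := by positivity
      rw [div_sub_one (by linarith), div_le_div_iff₀ (by linarith) hn0]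
      have : (((n + 1).choose 2 : ℕ) : ℝ) - m - (((n - 1).choose 2 : ℕ) - m + 1) = 2 * n - 2 := by
        rw [hA1, hA2]; ring
      rw [this]
      nlinarith
  rw [add_div]
  have e1 := (abs_le.1 d1).2
  have e2 := (abs_le.1 d2).1
  linarith

end Increments

/-! ### The sparse and dense regimes, and the one-edge bound for all `m` -/

section FirstMoment

variable {V : Type*} [DecidableEq V]

/-- A graph of minimum degree at least three on `K` has more than `|K|` edges. -/
theorem exists_dense_of_edgesHaveCore {q : ℕ} (hq : 3 ≤ q) {E : Finset (Sym2 V)}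
    (h : EdgesHaveCore q E) :
    ∃ K : Finset V, ∃ R ∈ (pairs K).powersetCard (K.card + 1), R ⊆ E := by
  obtain ⟨K, hK, hd⟩ := h
  refine ⟨K, ?_⟩
  set F := E ∩ pairs K with hF
  have hdeg : ∀ v ∈ K, 3 ≤ (F.filter fun e => v ∈ e).card := by
    intro v hv
    refine (hq.trans (hd v hv)).trans ?_
    refine Finset.card_le_card_of_injOn (fun w => s(v, w)) ?_ ?_
    · intro w hw
      simp only [Finset.coe_filter, Set.mem_ofPred_eq, hF, Finset.mem_inter, mk_mem_pairs] at hw ⊢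
      exact ⟨⟨hw.2.2, hv, hw.1, hw.2.1.symm⟩, Sym2.mem_mk_left v w⟩
    · intro a _ b _ hab
      exact Sym2.congr_right.1 hab
  have htwo : ∀ e ∈ F, (K.filter fun v => v ∈ e).card ≤ 2 := by
    intro e _
    induction e with | _ a b =>
    refine (Finset.card_le_card (t := {a, b}) ?_).trans Finset.card_le_two
    intro x hx
    simp only [Finset.mem_filter, Sym2.mem_iff] at hx
    simpa using hx.2
  have hcount : ∑ v ∈ K, (F.filter fun e => v ∈ e).card = ∑ e ∈ F, (K.filter fun v => v ∈ e).card :=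
    Finset.sum_card_bipartiteAbove_eq_sum_card_bipartiteBelow fun v e => v ∈ e
  have h1 : K.card * 3 ≤ ∑ v ∈ K, (F.filter fun e => v ∈ e).card :=
    Finset.card_nsmul_le_sum K _ 3 hdeg
  have h2 : ∑ e ∈ F, (K.filter fun v => v ∈ e).card ≤ F.card * 2 :=
    Finset.sum_le_card_nsmul F _ 2 htwo
  -- Here `q ≥ 3` is essential: `2 |F| ≥ 3 |K|` forces more edges than vertices, whereas a cycle has
  -- equally many.
  have h3 : K.card + 1 ≤ F.card := by
    have := Finset.card_pos.2 hK
    omega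
  obtain ⟨R, hRF, hR⟩ := Finset.exists_subset_card_eq h3
  exact ⟨R, Finset.mem_powersetCard.2 ⟨hRF.trans Finset.inter_subset_right, hR⟩,
    hRF.trans Finset.inter_subset_left⟩

theorem descFactorial_mul_pow_le_pow {m N : ℕ} (hmN : m ≤ N) (r : ℕ) :
    m.descFactorial r * N ^ r ≤ N.descFactorial r * m ^ r := by
  induction r with
  | zero => simp
  | succ r ih =>
    simp only [Nat.descFactorial_succ]
    have h1 : (m - r) * N ≤ (N - r) * m := by
      rw [Nat.sub_mul, Nat.sub_mul, mul_comm m N]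
      exact Nat.sub_le_sub_left (Nat.mul_le_mul_left _ hmN) _
    calc _ = ((m - r) * N) * (m.descFactorial r * N ^ r) := by ring
      _ ≤ ((N - r) * m) * (N.descFactorial r * m ^ r) := Nat.mul_le_mul h1 ih
      _ = _ := by ring

/-- A uniformly random `m`-subset of an `N`-set contains a given `r`-set with probability at
most `(m / N) ^ r`. -/
theorem card_filter_superset_le {α : Type*} [DecidableEq α] {P R : Finset α} {m : ℕ}
    (hR : R ⊆ P) (hm : m ≤ P.card) :
    (((P.powersetCard m).filter fun E => R ⊆ E).card : ℝ) ≤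
      (P.card.choose m : ℝ) * ((m : ℝ) / P.card) ^ R.card := by
  have hRP := Finset.card_le_card hR
  rcases lt_or_ge m R.card with hlt | hge
  · have : (P.powersetCard m).filter (fun E => R ⊆ E) = ∅ := by
      refine Finset.filter_eq_empty_iff.2 fun E hE hRE => ?_
      have h1 := Finset.card_le_card hRE
      rw [(Finset.mem_powersetCard.1 hE).2] at h1
      omega
    rw [this, Finset.card_empty, Nat.cast_zero]
    positivity
  have h1 : ((P.powersetCard m).filter fun E => R ⊆ E).card ≤
      (P.card - R.card).choose (m - R.card) := by
    rw [← Finset.card_sdiff_of_subset hR, ← Finset.card_powersetCard]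
    refine Finset.card_le_card_of_injOn (fun E => E \ R) ?_ ?_
    · intro E hE
      simp only [Finset.coe_filter, Finset.mem_powersetCard, Set.mem_ofPred_eq] at hE
      simp only [Finset.mem_coe, Finset.mem_powersetCard]
      refine ⟨Finset.sdiff_subset_sdiff hE.1.1 le_rfl, ?_⟩
      rw [Finset.card_sdiff_of_subset hE.2, hE.1.2]
    · intro E hE F hF hEF
      simp only [Finset.coe_filter, Set.mem_ofPred_eq] at hE hF
      have h : E \ R = F \ R := hEF
      rw [← Finset.sdiff_union_of_subset hE.2, h, Finset.sdiff_union_of_subset hF.2]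
  refine (Nat.cast_le.2 h1).trans ?_
  have h2 := Nat.choose_mul (n := P.card) hge
  rcases Nat.eq_zero_or_pos P.card with h0 | hpos
  · have hm0 : m = 0 := by omega
    have hr0 : R.card = 0 := by omega
    simp [h0, hm0, hr0]
  have hN : (0 : ℝ) < P.card := by exact_mod_cast hpos
  have hc : (0 : ℝ) < P.card.choose R.card := by exact_mod_cast Nat.choose_pos hRP
  have h3 : (m.choose R.card : ℝ) * P.card ^ R.card ≤ P.card.choose R.card * m ^ R.card := by
    have h := descFactorial_mul_pow_le_pow hm R.card
    simp only [Nat.descFactorial_eq_factorial_mul_choose, mul_assoc] at h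
    exact_mod_cast Nat.le_of_mul_le_mul_left h R.card.factorial_pos
  have h2' : (P.card.choose m : ℝ) * m.choose R.card =
      P.card.choose R.card * (P.card - R.card).choose (m - R.card) := by exact_mod_cast h2
  rw [div_pow, mul_div_assoc', le_div_iff₀ (by positivity)]
  refine le_of_mul_le_mul_left ?_ hc
  calc (P.card.choose R.card : ℝ) * ((P.card - R.card).choose (m - R.card) * P.card ^ R.card)
      = P.card.choose m * (m.choose R.card * P.card ^ R.card) := by
        rw [← mul_assoc, ← h2', mul_assoc]
    _ ≤ P.card.choose m * (P.card.choose R.card * m ^ R.card) := by gcongr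
    _ = _ := by ring

/-- Union bound over the vertex sets `K` of size `s` and the sets of `s + 1` edges inside `K`. -/
theorem coreProb_le_sum {q n m : ℕ} (hq : 3 ≤ q) (hm : m ≤ n.choose 2) :
    coreProb q n m ≤ ∑ s ∈ Finset.range (n + 1),
      (n.choose s : ℝ) * ((s.choose 2).choose (s + 1) * ((m : ℝ) / n.choose 2) ^ (s + 1)) := by
  set T : ℝ := (((n.choose 2).choose m : ℕ) : ℝ) with hTdef
  have hT : 0 < T := by rw [hTdef]; exact_mod_cast Nat.choose_pos hm
  rw [coreProb, ← hTdef, div_le_iff₀ hT]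
  set U : Finset (Fin n) := Finset.univ with hU
  have hUc : U.card = n := by simp [hU]
  have hpt : ∀ E : Finset (Sym2 (Fin n)), coreInd q E ≤
      ∑ K ∈ U.powerset, ∑ R ∈ (pairs K).powersetCard (K.card + 1), if R ⊆ E then (1 : ℝ) else 0 := by
    intro E
    have hnn : ∀ K ∈ U.powerset, 0 ≤ ∑ R ∈ (pairs K).powersetCard (K.card + 1),
        if R ⊆ E then (1 : ℝ) else 0 := fun K _ => Finset.sum_nonneg fun R _ => by
      split_ifs <;> norm_num
    by_cases h : EdgesHaveCore q E
    · obtain ⟨K, R, hR, hRE⟩ := exists_dense_of_edgesHaveCore hq h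
      refine le_trans ?_ (Finset.single_le_sum hnn (Finset.mem_powerset.2 (Finset.subset_univ K)))
      refine le_trans ?_ (Finset.single_le_sum (f := fun R => if R ⊆ E then (1 : ℝ) else 0)
        (fun R _ => by split_ifs <;> norm_num) hR)
      rw [if_pos hRE]
      exact coreInd_le_one _ _
    · rw [coreInd, if_neg h]
      exact Finset.sum_nonneg hnn
  refine (Finset.sum_le_sum fun E _ => hpt E).trans ?_
  rw [Finset.sum_comm]
  have hK : ∀ K ∈ U.powerset, ∑ E ∈ (pairs U).powersetCard m,
      ∑ R ∈ (pairs K).powersetCard (K.card + 1), (if R ⊆ E then (1 : ℝ) else 0) ≤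
      (K.card.choose 2).choose (K.card + 1) * (T * ((m : ℝ) / n.choose 2) ^ (K.card + 1)) := by
    intro K hK
    rw [Finset.sum_comm]
    refine (Finset.sum_le_card_nsmul _ _ _ fun R hR => ?_).trans_eq
      (by rw [nsmul_eq_mul, Finset.card_powersetCard, card_pairs])
    rw [Finset.mem_powersetCard] at hR
    have h := card_filter_superset_le (m := m) (hR.1.trans (pairs_mono (Finset.mem_powerset.1 hK)))
      (by rw [card_pairs, hUc]; exact hm)
    rw [card_pairs, hUc, hR.2] at h
    rw [← Finset.sum_filter]
    simpa using h
  refine (Finset.sum_le_sum hK).trans_eq ?_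
  rw [Finset.sum_powerset_apply_card
    (fun s => ((s.choose 2).choose (s + 1) : ℝ) * (T * ((m : ℝ) / n.choose 2) ^ (s + 1))),
    hUc, Finset.sum_mul]
  refine Finset.sum_congr rfl fun s _ => ?_
  rw [nsmul_eq_mul]
  ring

theorem exp_two_lt_eight : Real.exp 2 < 8 := by
  have h : Real.exp 2 = Real.exp 1 ^ 2 := by rw [← Real.exp_nat_mul]; norm_num
  have h1 := Real.exp_one_lt_d9
  have h0 := Real.exp_pos 1
  rw [h]
  nlinarith

/-- The factor `1 / n` comes from having one more edge than vertices. The powers of `s` over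
factorials cost `exp (2s) ≤ 8 ^ s`, the spare `s` costs `2 ^ s`, and `32 ^ (-(s + 1))` beats both.
-/
theorem choose_mul_choose_mul_pow_le {n s : ℕ} (hn : 0 < n) {y : ℝ} (hy : 0 ≤ y)
    (hyn : y ≤ 1 / (16 * n)) :
    (n.choose s : ℝ) * ((s.choose 2).choose (s + 1) * y ^ (s + 1)) ≤ (1 / 2) ^ s * (1 / n) := by
  have hn0 : (0 : ℝ) < n := by exact_mod_cast hn
  have hs0 : (0 : ℝ) ≤ s := Nat.cast_nonneg s
  have h1 : (n.choose s : ℝ) ≤ n ^ s / s.factorial := Nat.choose_le_pow_div s n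
  have h2 : ((s.choose 2).choose (s + 1) : ℝ) ≤ ((s : ℝ) ^ 2 / 2) ^ (s + 1) / (s + 1).factorial := by
    refine (Nat.choose_le_pow_div (s + 1) (s.choose 2)).trans ?_
    gcongr
    rw [Nat.cast_choose_two]
    nlinarith
  have h3 : (s : ℝ) ^ s / s.factorial ≤ Real.exp s := Real.pow_div_factorial_le_exp _ hs0 s
  have h4 : (s : ℝ) ^ (s + 1) / (s + 1).factorial ≤ Real.exp s :=
    Real.pow_div_factorial_le_exp _ hs0 (s + 1)
  have h5 : Real.exp s * Real.exp s ≤ 8 ^ s := by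
    rw [← Real.exp_add, show (s : ℝ) + s = s * 2 by ring, Real.exp_nat_mul]
    exact pow_le_pow_left₀ (Real.exp_pos _).le exp_two_lt_eight.le s
  have h6 : (s : ℝ) ≤ 2 ^ s := by exact_mod_cast Nat.lt_two_pow_self.le
  calc (n.choose s : ℝ) * ((s.choose 2).choose (s + 1) * y ^ (s + 1))
      ≤ (n ^ s / s.factorial) * ((((s : ℝ) ^ 2 / 2) ^ (s + 1) / (s + 1).factorial) *
        (1 / (16 * n)) ^ (s + 1)) := by gcongr
    _ = ((s : ℝ) ^ s / s.factorial) * ((s : ℝ) ^ (s + 1) / (s + 1).factorial) * s *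
        ((1 / 32) ^ (s + 1) * (1 / n)) := by
      rw [show (1 / 32 : ℝ) = 1 / 2 * (1 / 16) by norm_num]
      simp only [div_pow, mul_pow, one_pow]
      field_simp
      ring
    _ ≤ Real.exp s * Real.exp s * 2 ^ s * ((1 / 32) ^ (s + 1) * (1 / n)) := by gcongr
    _ ≤ 8 ^ s * 2 ^ s * ((1 / 32) ^ (s + 1) * (1 / n)) := by gcongr
    _ = (1 / 2) ^ s * (1 / n) * (1 / 32) := by
      rw [← mul_pow, pow_succ, show (8 * 2 : ℝ) = 1 / 2 * 32 by norm_num, mul_pow, div_pow 1 32, one_pow]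
      field_simp
    _ ≤ (1 / 2) ^ s * (1 / n) := by
      have : (0 : ℝ) ≤ (1 / 2) ^ s * (1 / n) := by positivity
      linarith

/-- Very sparse random graphs have a `q`-core with probability `O(1 / n)`. -/
theorem coreProb_le_of_sparse {q n m : ℕ} (hq : 3 ≤ q) (hn : 2 ≤ n) (hm : (m : ℝ) ≤ 1 / 64 * n) :
    coreProb q n m ≤ 2 / n := by
  have hn2 : (2 : ℝ) ≤ n := by exact_mod_cast hn
  have hn0 : (0 : ℝ) < n := by linarith
  have hA : ((n.choose 2 : ℕ) : ℝ) = n * (n - 1) / 2 := Nat.cast_choose_two ℝ n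
  have hmA : m ≤ n.choose 2 := by
    have : (m : ℝ) ≤ (n.choose 2 : ℕ) := by rw [hA]; nlinarith
    exact_mod_cast this
  -- The constant `64` suffices because `n - 1 ≥ n / 2`.
  have hy : (m : ℝ) / n.choose 2 ≤ 1 / (16 * n) := by
    rw [hA, div_le_div_iff₀ (by nlinarith) (by positivity)]
    nlinarith
  refine (coreProb_le_sum hq hmA).trans ?_
  refine (Finset.sum_le_sum fun s _ =>
    choose_mul_choose_mul_pow_le (by omega) (by positivity) hy).trans ?_
  rw [← Finset.sum_mul]
  have := Summable.sum_le_tsum (Finset.range (n + 1))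
    (fun i _ => by positivity : ∀ i ∉ Finset.range (n + 1), (0 : ℝ) ≤ (1 / 2) ^ i)
    summable_geometric_two
  rw [tsum_geometric_two] at this
  rw [div_eq_mul_one_div 2 (n : ℝ)]
  gcongr

theorem coreProb_eq_one {q n m : ℕ} (hm : m ≤ n.choose 2) (hqm : (q - 1) * n < m) :
    coreProb q n m = 1 := by
  have hT : ((n.choose 2).choose m : ℝ) ≠ 0 := by exact_mod_cast (Nat.choose_pos hm).ne'
  rw [coreProb, coreCount, div_eq_one_iff_eq hT, Finset.sum_congr rfl (g := fun _ => (1 : ℝ))]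
  · simp [card_pairs]
  · intro E hE
    rw [Finset.mem_powersetCard] at hE
    exact if_pos (edgesHaveCore_of_card _ E hE.1 (by simpa [hE.2] using hqm))

/-- An additional edge changes the probability of a `q`-core by at most `O(n ^ (-1/2))`. -/
theorem exists_coreProb_succ_sub_le {q : ℕ} (hq : 3 ≤ q) :
    ∃ C : ℝ, 0 < C ∧ ∀ᶠ n : ℕ in atTop, ∀ m < n.choose 2,
      coreProb q n (m + 1) - coreProb q n m ≤ C / √n := by
  set D := √((Real.exp (-(8 * (q : ℝ))))⁻¹) + √((1 / 64 * Real.exp (-(8 * (q : ℝ))))⁻¹ + 8) with hD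
  have hD0 : 0 ≤ D := by positivity
  -- The `2` absorbs the sparse bound `2 / n`. With `n ≥ 128`, leaving the sparse range forces `m ≥
  -- 1`; `4 * q + 6 ≤ n` is the linear-regime condition for `K = q`.
  refine ⟨D + 2, by positivity, eventually_atTop.2 ⟨max 128 (4 * q + 6), fun n hn m hm => ?_⟩⟩
  have hn1 : 128 ≤ n := (le_max_left _ _).trans hn
  have hn2 : 4 * q + 6 ≤ n := (le_max_right _ _).trans hn
  have hn0 : (128 : ℝ) ≤ n := by exact_mod_cast hn1
  have hs : 0 < √(n : ℝ) := Real.sqrt_pos.2 (by linarith)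
  rcases le_or_gt ((m : ℝ) + 1) (1 / 64 * n) with h | h
  · have h1 := coreProb_le_of_sparse (q := q) (n := n) (m := m + 1) hq (by omega)
      (by push_cast; exact h)
    have h2 := coreProb_nonneg q n m
    have h3 : (2 : ℝ) / n ≤ (D + 2) / √n := by
      have : √(n : ℝ) ≤ n := by
        rw [Real.sqrt_le_left (by linarith)]
        nlinarith
      gcongr
      linarith
    linarith
  rcases le_or_gt m ((q - 1) * n) with h' | h'
  · have hm1 : 1 ≤ m := by
      have : (0 : ℝ) < m := by linarith
      exact_mod_cast this
    have hK : m + 1 ≤ q * n := by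
      obtain ⟨k, rfl⟩ : ∃ k, q = k + 1 := ⟨q - 1, by omega⟩
      rw [Nat.add_sub_cancel] at h'
      rw [add_mul]
      omega
    refine (coreProb_succ_sub_le_of_linear (by omega) (by norm_num : (0 : ℝ) < 1 / 64)
      (by omega) hn2 hK hm1 h.le).trans ?_
    rw [← hD]
    gcongr
    linarith
  · rw [coreProb_eq_one hm.le h']
    have := coreProb_le_one q n (m + 1)
    have : 0 ≤ (D + 2) / √n := by positivity
    linarith

end FirstMoment

/-! ### Sampling with replacement as a mixture of uniform subsets -/

section Replacement

variable {α : Type*} [Fintype α] [DecidableEq α]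

/-- Double counting: a set `F` of size `d + 1` arises once for each of its elements. -/
theorem sum_insert_notMem (h : Finset α → ℝ) (d : ℕ) :
    ∑ E ∈ (Finset.univ : Finset α).powersetCard d, ∑ a ∈ Eᶜ, h (insert a E) =
      (d + 1) * ∑ F ∈ (Finset.univ : Finset α).powersetCard (d + 1), h F := by
  have h1 : ((d : ℝ) + 1) * ∑ F ∈ (Finset.univ : Finset α).powersetCard (d + 1), h F =
      ∑ F ∈ (Finset.univ : Finset α).powersetCard (d + 1), ∑ _a ∈ F, h F := by
    rw [Finset.mul_sum]
    refine Finset.sum_congr rfl fun F hF => ?_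
    rw [Finset.sum_const, (Finset.mem_powersetCard.1 hF).2, nsmul_eq_mul]
    push_cast
    rfl
  rw [h1, Finset.sum_sigma', Finset.sum_sigma']
  refine Finset.sum_bij' (fun x _ => ⟨insert x.2 x.1, x.2⟩) (fun x _ => ⟨x.1.erase x.2, x.2⟩)
    ?_ ?_ ?_ ?_ ?_
  · rintro ⟨E, a⟩ hx
    simp only [Finset.mem_sigma, Finset.mem_powersetCard, Finset.mem_compl] at hx ⊢
    exact ⟨⟨Finset.subset_univ _, by rw [Finset.card_insert_of_notMem hx.2, hx.1.2]⟩,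
      Finset.mem_insert_self _ _⟩
  · rintro ⟨F, a⟩ hx
    simp only [Finset.mem_sigma, Finset.mem_powersetCard, Finset.mem_compl] at hx ⊢
    exact ⟨⟨Finset.subset_univ _, by rw [Finset.card_erase_of_mem hx.2, hx.1.2]; rfl⟩,
      Finset.notMem_erase _ _⟩
  · rintro ⟨E, a⟩ hx
    simp only [Finset.mem_sigma, Finset.mem_compl] at hx
    simp [Finset.erase_insert hx.2]
  · rintro ⟨F, a⟩ hx
    simp only [Finset.mem_sigma] at hx
    simp [Finset.insert_erase hx.2]
  · rintro ⟨E, a⟩ _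
    rfl

theorem sum_powersetCard_sum_insert (h : Finset α → ℝ) (d : ℕ) :
    ∑ E ∈ (Finset.univ : Finset α).powersetCard d, ∑ a, h (insert a E) =
      d * ∑ E ∈ (Finset.univ : Finset α).powersetCard d, h E +
      (d + 1) * ∑ F ∈ (Finset.univ : Finset α).powersetCard (d + 1), h F := by
  rw [← sum_insert_notMem, Finset.mul_sum, ← Finset.sum_add_distrib]
  refine Finset.sum_congr rfl fun E hE => ?_
  rw [← Finset.sum_add_sum_compl E]
  congr 1
  rw [Finset.sum_congr rfl fun a ha => by rw [Finset.insert_eq_of_mem ha], Finset.sum_const,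
    (Finset.mem_powersetCard.1 hE).2, nsmul_eq_mul]

theorem sum_image_succ (h : Finset α → ℝ) (m : ℕ) :
    ∑ f : Fin (m + 1) → α, h (Finset.univ.image f) =
      ∑ f : Fin m → α, ∑ a, h (insert a (Finset.univ.image f)) := by
  rw [← (Fin.consEquiv fun _ => α).sum_comp, Fintype.sum_prod_type, Finset.sum_comm]
  refine Finset.sum_congr rfl fun f _ => Finset.sum_congr rfl fun a _ => ?_
  congr 1
  ext x
  simp [Fin.exists_fin_succ, Fin.consEquiv, eq_comm]

/-- The set of values of a uniformly random function, given its cardinality, is uniformly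
distributed. -/
theorem exists_weights_sum_image (α : Type*) [Fintype α] [DecidableEq α] (m : ℕ) :
    ∃ w : ℕ → ℝ, (∀ d, 0 ≤ w d) ∧ ∀ h : Finset α → ℝ,
      ∑ f : Fin m → α, h (Finset.univ.image f) =
        ∑ d ∈ Finset.range (m + 1), w d *
          ∑ E ∈ (Finset.univ : Finset α).powersetCard d, h E := by
  induction m with
  | zero =>
    refine ⟨fun _ => 1, fun _ => zero_le_one, fun h => ?_⟩
    simp
  | succ m ih =>
    obtain ⟨w, hw, hsum⟩ := ih
    -- Size `d` is reached by repeating a value (`d` ways) or by a new value from size `d - 1`. The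
    -- guard discards `w (m + 1)`, about which the induction hypothesis says nothing.
    refine ⟨fun d => (if d < m + 1 then d * w d else 0) + d * w (d - 1), fun d => ?_, fun h => ?_⟩
    · have h1 := hw d
      have h2 := hw (d - 1)
      dsimp only
      split_ifs <;> positivity
    · rw [sum_image_succ, hsum fun E => ∑ a, h (insert a E)]
      simp_rw [sum_powersetCard_sum_insert, mul_add, add_mul]
      rw [Finset.sum_add_distrib, Finset.sum_add_distrib]
      congr 1
      · rw [Finset.sum_range_succ _ (m + 1), if_neg (lt_irrefl _), zero_mul, add_zero]
        refine Finset.sum_congr rfl fun d hd => ?_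
        rw [if_pos (Finset.mem_range.1 hd)]
        ring
      · rw [Finset.sum_range_succ' _ (m + 1)]
        simp only [Nat.cast_zero, zero_mul, add_zero, Nat.add_sub_cancel]
        refine Finset.sum_congr rfl fun d _ => ?_
        push_cast
        ring

/-- If the mean of `h` over subsets of size `d` increases by at most `η` with `d`, then the mean
of `h` over the value sets of `m` independent samples increases by at most `η` with `m`. -/
theorem sum_image_succ_sub_le (h : Finset α → ℝ) {η : ℝ} (hη : 0 ≤ η)
    (hα : 0 < Fintype.card α)
    (hstep : ∀ d < Fintype.card α,
      (∑ E ∈ (Finset.univ : Finset α).powersetCard (d + 1), h E) /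
          (Fintype.card α).choose (d + 1) -
        (∑ E ∈ (Finset.univ : Finset α).powersetCard d, h E) / (Fintype.card α).choose d ≤ η)
    (m : ℕ) :
    (∑ f : Fin (m + 1) → α, h (Finset.univ.image f)) / (Fintype.card α : ℝ) ^ (m + 1) -
      (∑ f : Fin m → α, h (Finset.univ.image f)) / (Fintype.card α : ℝ) ^ m ≤ η := by
  set N := Fintype.card α with hN
  have hN0 : (0 : ℝ) < N := by exact_mod_cast hα
  obtain ⟨w, hw, hsum⟩ := exists_weights_sum_image α m
  have htot : ∑ d ∈ Finset.range (m + 1), w d * (N.choose d : ℝ) = (N : ℝ) ^ m := by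
    have := hsum fun _ => 1
    simp only [Finset.sum_const, Finset.card_univ, Finset.card_powersetCard, nsmul_eq_mul,
      mul_one, Fintype.card_fun, Fintype.card_fin, ← hN] at this
    rw [← this]
    push_cast
    rfl
  -- For `d < N` the left side is `N.choose d * (N - d)` times the increment of the mean, the draw
  -- being new in `N - d` of `N` cases.
  have hd : ∀ d : ℕ, (d : ℝ) * ∑ E ∈ (Finset.univ : Finset α).powersetCard d, h E +
      (d + 1) * ∑ F ∈ (Finset.univ : Finset α).powersetCard (d + 1), h F -
      N * ∑ E ∈ (Finset.univ : Finset α).powersetCard d, h E ≤ N * η * N.choose d := by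
    intro d
    rcases lt_trichotomy d N with hlt | rfl | hgt
    · have hs := hstep d hlt
      have hc : (N.choose (d + 1) : ℝ) * (d + 1) = N.choose d * (N - d) := by
        have := Nat.choose_succ_right_eq N d
        rw [← Nat.cast_sub hlt.le]
        exact_mod_cast this
      have hp0 : (0 : ℝ) < N.choose d := by exact_mod_cast Nat.choose_pos hlt.le
      have hp1 : (0 : ℝ) < N.choose (d + 1) := by exact_mod_cast Nat.choose_pos hlt
      have hdN : (d : ℝ) ≤ N := by exact_mod_cast hlt.le
      set A := ∑ E ∈ (Finset.univ : Finset α).powersetCard d, h E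
      set B := ∑ F ∈ (Finset.univ : Finset α).powersetCard (d + 1), h F
      have hA : A = A / N.choose d * N.choose d := by field_simp
      have hB : B = B / N.choose (d + 1) * N.choose (d + 1) := by field_simp
      have hcn : 0 ≤ (N.choose d : ℝ) * (N - d) := mul_nonneg hp0.le (by linarith)
      calc (d : ℝ) * A + (d + 1) * B - N * A
          = (B / N.choose (d + 1) - A / N.choose d) * (N.choose d * (N - d)) := by
            rw [sub_mul, ← hc]
            nth_rewrite 1 [hB]
            rw [hc]
            nth_rewrite 1 2 [hA]
            have : B / (N.choose (d + 1) : ℝ) * N.choose (d + 1) * (d + 1) =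
              B / (N.choose (d + 1) : ℝ) * (N.choose d * (N - d)) := by rw [← hc]; ring
            linear_combination this
        _ ≤ η * (N.choose d * (N - d)) := mul_le_mul_of_nonneg_right hs hcn
        _ ≤ η * (N.choose d * N) := by
          gcongr
          linarith [Nat.cast_nonneg (α := ℝ) d]
        _ = _ := by ring
    · have : (Finset.univ : Finset α).powersetCard (N + 1) = ∅ :=
        Finset.powersetCard_eq_empty.2 (by rw [Finset.card_univ]; omega)
      rw [this, Finset.sum_empty]
      have : 0 ≤ (N : ℝ) * η * N.choose N := by positivity
      linarith
    · have h1 : (Finset.univ : Finset α).powersetCard (d + 1) = ∅ :=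
        Finset.powersetCard_eq_empty.2 (by rw [Finset.card_univ]; omega)
      have h2 : (Finset.univ : Finset α).powersetCard d = ∅ :=
        Finset.powersetCard_eq_empty.2 (by rw [Finset.card_univ]; omega)
      rw [h1, h2, Finset.sum_empty]
      have : 0 ≤ (N : ℝ) * η * N.choose d := by positivity
      linarith
  rw [pow_succ, div_sub_div _ _ (by positivity) (by positivity), div_le_iff₀ (by positivity),
    sum_image_succ, hsum fun E => ∑ a, h (insert a E), hsum h]
  simp_rw [sum_powersetCard_sum_insert]
  have key : ∑ d ∈ Finset.range (m + 1), w d *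
        (d * ∑ E ∈ (Finset.univ : Finset α).powersetCard d, h E +
          (d + 1) * ∑ F ∈ (Finset.univ : Finset α).powersetCard (d + 1), h F) -
      N * ∑ d ∈ Finset.range (m + 1), w d *
        ∑ E ∈ (Finset.univ : Finset α).powersetCard d, h E ≤ N * η * (N : ℝ) ^ m := by
    rw [Finset.mul_sum, ← Finset.sum_sub_distrib, ← htot, Finset.mul_sum]
    refine Finset.sum_le_sum fun d _ => ?_
    have := mul_le_mul_of_nonneg_left (hd d) (hw d)
    linarith
  have hpm : (0 : ℝ) ≤ (N : ℝ) ^ m := by positivity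
  have := mul_le_mul_of_nonneg_right key hpm
  linarith

/-- If `h` takes the value one on the full set, its mean over the value sets of `m` independent
samples comes close to one. -/
theorem one_sub_le_sum_image (h : Finset α → ℝ) (h0 : ∀ E, 0 ≤ h E) (h1 : h Finset.univ = 1)
    (hα : 0 < Fintype.card α) (m : ℕ) :
    1 - Fintype.card α * (1 - 1 / (Fintype.card α : ℝ)) ^ m ≤
      (∑ f : Fin m → α, h (Finset.univ.image f)) / (Fintype.card α : ℝ) ^ m := by
  set N := Fintype.card α with hN
  have hN0 : (0 : ℝ) < N := by exact_mod_cast hα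
  rw [le_div_iff₀ (by positivity)]
  -- Union bound over the values missed by the sample, as for the coupon collector.
  have hpt : ∀ f : Fin m → α,
      1 - h (Finset.univ.image f) ≤ ∑ a, if ∀ i, f i ≠ a then (1 : ℝ) else 0 := by
    intro f
    have hnn : ∀ a ∈ (Finset.univ : Finset α), (0 : ℝ) ≤ if ∀ i, f i ≠ a then (1 : ℝ) else 0 :=
      fun a _ => by split_ifs <;> norm_num
    by_cases hf : ∃ a, ∀ i, f i ≠ a
    · obtain ⟨a, ha⟩ := hf
      have := Finset.single_le_sum hnn (Finset.mem_univ a)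
      rw [if_pos ha] at this
      linarith [h0 (Finset.univ.image f)]
    · push Not at hf
      have : Finset.univ.image f = Finset.univ := by
        ext a; simpa using hf a
      rw [this, h1, sub_self]
      exact Finset.sum_nonneg hnn
  have hcount : ∀ a : α, ∑ f : Fin m → α, (if ∀ i, f i ≠ a then (1 : ℝ) else 0) =
      ((N : ℝ) - 1) ^ m := by
    intro a
    rw [Finset.sum_boole]
    have : (Finset.univ.filter fun f : Fin m → α => ∀ i, f i ≠ a) =
        Fintype.piFinset fun _ => Finset.univ.erase a := by
      ext f; simp [Fintype.mem_piFinset]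
    rw [this, Fintype.card_piFinset, Finset.prod_const, Finset.card_erase_of_mem (Finset.mem_univ a),
      Finset.card_univ, Finset.card_univ, Fintype.card_fin, ← hN]
    push_cast [Nat.cast_sub (show 1 ≤ N from hα)]
    rfl
  have hle := Finset.sum_le_sum fun f (_ : f ∈ (Finset.univ : Finset (Fin m → α))) => hpt f
  rw [Finset.sum_comm, Finset.sum_congr rfl fun a _ => hcount a, Finset.sum_sub_distrib] at hle
  simp only [Finset.sum_const, Finset.card_univ, nsmul_eq_mul, mul_one, Fintype.card_fun,
    Fintype.card_fin, ← hN] at hle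
  push_cast at hle
  have e : (1 - (N : ℝ) * (1 - 1 / N) ^ m) * N ^ m = (N : ℝ) ^ m - N * (N - 1) ^ m := by
    rw [sub_mul, one_mul, mul_assoc, ← mul_pow, sub_mul, one_mul, one_div,
      inv_mul_cancel₀ hN0.ne']
  rw [e]
  linarith

end Replacement

/-! ### Translation to the stated probabilities and widths -/

section Width

theorem hasQCore_fromEdgeSet_iff {V : Type*} [Fintype V] [DecidableEq V] (q : ℕ)
    (E : Finset (Sym2 V)) :
    HasQCore q (SimpleGraph.fromEdgeSet (E : Set (Sym2 V))) ↔ EdgesHaveCore q E := by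
  classical
  rw [hasQCore_iff]
  constructor
  · rintro ⟨H, hne, hH⟩
    refine ⟨H.verts.toFinset, Set.toFinset_nonempty.2 hne, fun v hv => ?_⟩
    have h := hH v (Set.mem_toFinset.1 hv)
    have hsub : H.neighborSet v ⊆
        ((H.verts.toFinset.filter fun w => w ≠ v ∧ s(v, w) ∈ E : Finset V) : Set V) := by
      intro w hw
      have hw' : H.Adj v w := hw
      have hadj := H.adj_sub hw'
      rw [SimpleGraph.fromEdgeSet_adj] at hadj
      simp only [Finset.coe_filter, Set.mem_toFinset, Set.mem_ofPred_eq]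
      exact ⟨H.edge_vert hw'.symm, hadj.2.symm, hadj.1⟩
    have h2 := h.trans (Set.encard_le_encard hsub)
    rw [Set.encard_coe_eq_coe_finsetCard] at h2
    exact_mod_cast h2
  · rintro ⟨K, hK, hd⟩
    let H : (SimpleGraph.fromEdgeSet (E : Set (Sym2 V))).Subgraph :=
      { verts := K
        Adj := fun a b => a ∈ K ∧ b ∈ K ∧ a ≠ b ∧ s(a, b) ∈ E
        adj_sub := fun h => (SimpleGraph.fromEdgeSet_adj _).2 ⟨h.2.2.2, h.2.2.1⟩
        edge_vert := fun h => h.1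
        symm := ⟨fun a b h => ⟨h.2.1, h.1, h.2.2.1.symm, by rw [Sym2.eq_swap]; exact h.2.2.2⟩⟩ }
    refine ⟨H, hK, fun v hv => ?_⟩
    have hv' : v ∈ K := hv
    have : H.neighborSet v =
        ((K.filter fun w => w ≠ v ∧ s(v, w) ∈ E : Finset V) : Set V) := by
      ext w
      simp only [Finset.coe_filter, Set.mem_ofPred_eq]
      exact ⟨fun h => ⟨h.2.1, h.2.2.1.symm, h.2.2.2⟩, fun h => ⟨hv', h.1, h.2.1.symm, h.2.2⟩⟩
    rw [this, Set.encard_coe_eq_coe_finsetCard]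
    exact_mod_cast hd v hv'

theorem coreInd_eq_ite {V : Type*} [Fintype V] [DecidableEq V] (q : ℕ) (E : Finset (Sym2 V))
    [Decidable (HasQCore q (SimpleGraph.fromEdgeSet (E : Set (Sym2 V))))] :
    coreInd q E = if HasQCore q (SimpleGraph.fromEdgeSet (E : Set (Sym2 V))) then 1 else 0 := by
  by_cases h : EdgesHaveCore q E
  · rw [coreInd, if_pos h, if_pos ((hasQCore_fromEdgeSet_iff q E).2 h)]
  · rw [coreInd, if_neg h, if_neg (mt (hasQCore_fromEdgeSet_iff q E).1 h)]

theorem mem_edgeSet_top_iff {n : ℕ} {e : Sym2 (Fin n)} :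
    e ∈ (⊤ : SimpleGraph (Fin n)).edgeSet ↔ e ∈ pairs (Finset.univ : Finset (Fin n)) := by
  rw [SimpleGraph.edgeSet_top, mem_pairs]
  simp

theorem coreProbWithoutRepl_eq (q n m : ℕ) : coreProbWithoutRepl q n m = coreProb q n m := by
  classical
  have hE : (⊤ : SimpleGraph (Fin n)).edgeFinset = pairs (Finset.univ : Finset (Fin n)) := by
    ext e
    rw [SimpleGraph.mem_edgeFinset, mem_edgeSet_top_iff]
  have hc : (pairs (Finset.univ : Finset (Fin n))).card = n.choose 2 := by simp [card_pairs]
  unfold coreProbWithoutRepl coreProb coreCount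
  rw [← Finset.sum_boole, Finset.card_powersetCard]
  congr 1
  · rw [← hE]
    simp only [coreInd_eq_ite]
    -- The numerator ranges over the edge sets coerced to `Set` through a monadic image; as the
    -- coercion is injective, the count is unchanged.
    have himage : (do
        let s ← (⊤ : SimpleGraph (Fin n)).edgeFinset.powersetCard m
        pure (s : Set (Sym2 (Fin n)))) =
        ((⊤ : SimpleGraph (Fin n)).edgeFinset.powersetCard m).map
          ⟨fun s : Finset (Sym2 (Fin n)) => (s : Set (Sym2 (Fin n))), Finset.coe_injective⟩ := by
      ext t
      simp [Finset.bind_def, eq_comm]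
    rw [himage, Finset.sum_map]
    congr!
  · rw [← hc, ← hE]

theorem card_edgeSet_top (n : ℕ) :
    Fintype.card (⊤ : SimpleGraph (Fin n)).edgeSet = n.choose 2 := by
  rw [← SimpleGraph.edgeFinset_card, SimpleGraph.card_edgeFinset_top_eq_card_choose_two,
    Fintype.card_fin]

theorem coreProbWithRepl_eq (q n m : ℕ) :
    coreProbWithRepl q n m =
      (∑ f : Fin m → (⊤ : SimpleGraph (Fin n)).edgeSet,
        coreInd q ((Finset.univ.image f).map (Function.Embedding.subtype _))) /
      (Fintype.card (⊤ : SimpleGraph (Fin n)).edgeSet : ℝ) ^ m := by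
  classical
  unfold coreProbWithRepl
  rw [← Finset.sum_boole]
  congr 1
  · refine Finset.sum_congr rfl fun f _ => ?_
    have : (Set.range fun i => (f i : Sym2 (Fin n))) =
        (((Finset.univ.image f).map (Function.Embedding.subtype _) : Finset (Sym2 (Fin n))) :
          Set (Sym2 (Fin n))) := by
      ext e; simp
    rw [coreInd_eq_ite]
    simp only [this]
  · rw [Fintype.card_fun, Fintype.card_fin]
    push_cast
    rfl

theorem sum_powersetCard_edgeSet_top (q n d : ℕ) :
    ∑ E ∈ (Finset.univ : Finset (⊤ : SimpleGraph (Fin n)).edgeSet).powersetCard d,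
      coreInd q (E.map (Function.Embedding.subtype _)) =
    coreCount q (Finset.univ : Finset (Fin n)) d := by
  have h : (Finset.univ : Finset (⊤ : SimpleGraph (Fin n)).edgeSet).map
      (Function.Embedding.subtype _) = pairs (Finset.univ : Finset (Fin n)) := by
    ext e
    simp [← mem_edgeSet_top_iff]
  rw [coreCount, ← h, Finset.powersetCard_map, Finset.sum_map]
  rfl

theorem coreProbWithRepl_succ_sub_le {q n : ℕ} {η : ℝ} (hη : 0 ≤ η) (hn : 2 ≤ n)
    (h : ∀ d < n.choose 2, coreProb q n (d + 1) - coreProb q n d ≤ η) (m : ℕ) :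
    coreProbWithRepl q n (m + 1) - coreProbWithRepl q n m ≤ η := by
  rw [coreProbWithRepl_eq, coreProbWithRepl_eq]
  refine sum_image_succ_sub_le
    (fun E => coreInd q (E.map (Function.Embedding.subtype _))) hη ?_ ?_ m
  · rw [card_edgeSet_top]; exact Nat.choose_pos hn
  · intro d hd
    rw [sum_powersetCard_edgeSet_top, sum_powersetCard_edgeSet_top]
    simp only [card_edgeSet_top] at hd ⊢
    exact h d hd

theorem coreProb_zero {q : ℕ} (hq : 1 ≤ q) (n : ℕ) : coreProb q n 0 = 0 := by
  simp [coreProb, coreCount, coreInd, not_edgesHaveCore_empty hq]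

theorem coreProbWithRepl_zero {q : ℕ} (hq : 1 ≤ q) (n : ℕ) : coreProbWithRepl q n 0 = 0 := by
  rw [coreProbWithRepl_eq]
  simp [coreInd, not_edgesHaveCore_empty hq]

/-- After enough draws all edges have probably appeared, and by `hqn` the complete graph has a core.
This makes the width with replacement well defined. -/
theorem exists_le_coreProbWithRepl {q n : ℕ} (hn : 2 ≤ n) (hqn : (q - 1) * n < n.choose 2)
    {p : ℝ} (hp : p < 1) : ∃ m, p ≤ coreProbWithRepl q n m := by
  have hN : 0 < n.choose 2 := Nat.choose_pos hn
  have hN0 : (1 : ℝ) ≤ n.choose 2 := by exact_mod_cast hN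
  have hlim : Tendsto (fun m : ℕ => 1 - (n.choose 2 : ℝ) * (1 - 1 / (n.choose 2 : ℝ)) ^ m) atTop
      (nhds (1 - (n.choose 2 : ℝ) * 0)) := by
    refine tendsto_const_nhds.sub (tendsto_const_nhds.mul ?_)
    refine tendsto_pow_atTop_nhds_zero_of_lt_one ?_ ?_
    · rw [sub_nonneg, div_le_one (by linarith)]; exact hN0
    · have : 0 < 1 / (n.choose 2 : ℝ) := by positivity
      linarith
  rw [mul_zero, sub_zero] at hlim
  obtain ⟨m, hm⟩ := (hlim.eventually (lt_mem_nhds hp)).exists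
  refine ⟨m, hm.le.trans ?_⟩
  rw [coreProbWithRepl_eq, ← card_edgeSet_top]
  refine one_sub_le_sum_image
    (fun E : Finset (⊤ : SimpleGraph (Fin n)).edgeSet =>
      coreInd q (E.map (Function.Embedding.subtype _))) (fun E => coreInd_nonneg _ _) ?_
    (by rw [card_edgeSet_top]; exact hN) m
  refine if_pos (edgesHaveCore_of_card Finset.univ _ (fun e he => ?_) ?_)
  · obtain ⟨e', -, rfl⟩ := Finset.mem_map.1 he
    exact mem_edgeSet_top_iff.1 e'.2
  · have hc := card_edgeSet_top n
    rw [← Finset.card_univ] at hc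
    rw [Finset.card_map, hc, Finset.card_univ, Fintype.card_fin]
    exact hqn

/-- If single steps increase `P` by at most `η`, the transition from `p₁` to `p₂` takes at least
`(p₂ - p₁) / η` steps. -/
theorem sub_le_mul_transitionWidth {I : Set ℕ} (hI : IsLowerSet I) {P : ℕ → ℝ} {p₁ p₂ η : ℝ}
    (hstep : ∀ m, m + 1 ∈ I → P (m + 1) - P m ≤ η)
    (hne : ∃ m ∈ I, P 0 ≤ p₁ ∧ p₂ ≤ P m) :
    p₂ - p₁ ≤ η * (transitionWidth I P p₁ p₂ : ℝ) := by
  -- Nonemptiness matters: the infimum of the empty set would be the default `0`.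
  have hmem : transitionWidth I P p₁ p₂ ∈
      {Δ : ℕ | ∃ m : ℕ, m ∈ I ∧ m + Δ ∈ I ∧ P m ≤ p₁ ∧ p₂ ≤ P (m + Δ)} := by
    refine Nat.sInf_mem ?_
    obtain ⟨m, hm, h0, h1⟩ := hne
    exact ⟨m, 0, hI (Nat.zero_le m) hm, by rwa [zero_add], h0, by rwa [zero_add]⟩
  obtain ⟨m, -, hmΔ, h1, h2⟩ := hmem
  have main : ∀ Δ : ℕ, m + Δ ∈ I → P (m + Δ) - P m ≤ η * Δ := by
    intro Δ
    induction Δ with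
    | zero => simp
    | succ Δ ih =>
      intro h
      have h3 := ih (hI (by omega) h)
      have h4 := hstep (m + Δ) h
      rw [← add_assoc]
      push_cast
      linarith
  linarith [main _ hmΔ]

end Width

end RandomGraphCore

theorem mainTheorem3 (q : ℕ) (hq : 3 ≤ q) :
    ∃ c : ℝ, 0 < c ∧ ∀ p₁ p₂ : ℝ, 0 < p₁ → p₁ < p₂ → p₂ < 1 →
      ∀ᶠ n : ℕ in atTop,
        c * (p₂ - p₁) * Real.sqrt n ≤ (RandomGraphCore.coreWidthWithoutRepl q n p₁ p₂ : ℝ) ∧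
        c * (p₂ - p₁) * Real.sqrt n ≤ (RandomGraphCore.coreWidthWithRepl q n p₁ p₂ : ℝ) := by
  obtain ⟨C, hC, hev⟩ := RandomGraphCore.exists_coreProb_succ_sub_le hq
  refine ⟨C⁻¹, inv_pos.2 hC, fun p₁ p₂ hp₁ _ hp₂ => ?_⟩
  -- From `n ≥ 2 q` follows `n - 1 > 2 (q - 1)`, so the complete graph exceeds `(q - 1) n` edges.
  filter_upwards [hev, eventually_ge_atTop (2 * q)] with n hn hnq
  have hn2 : 2 ≤ n := by omega
  have hs : 0 < √(n : ℝ) := Real.sqrt_pos.2 (by exact_mod_cast (by omega : 0 < n))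
  have hqn : (q - 1) * n < n.choose 2 := by
    rw [Nat.choose_two_right, Nat.lt_div_iff_mul_lt_of_dvd (by norm_num)
      (Nat.even_mul_pred_self n).two_dvd]
    have h1 : 2 * (q - 1) < n - 1 := by omega
    have := Nat.mul_lt_mul_of_pos_left h1 (by omega : 0 < n)
    linarith [mul_comm (q - 1) n, mul_left_comm n 2 (q - 1)]
  have conclude : ∀ w : ℕ, p₂ - p₁ ≤ C / √n * w → C⁻¹ * (p₂ - p₁) * √n ≤ w := by
    intro w hw
    rw [div_mul_eq_mul_div, le_div_iff₀ hs] at hw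
    rw [mul_assoc, inv_mul_le_iff₀ hC]
    exact hw
  constructor
  · refine conclude _ (RandomGraphCore.sub_le_mul_transitionWidth (isLowerSet_Iic _) ?_ ?_)
    · intro m hm
      rw [RandomGraphCore.coreProbWithoutRepl_eq, RandomGraphCore.coreProbWithoutRepl_eq]
      exact hn m hm
    · refine ⟨n.choose 2, le_refl (n.choose 2), ?_, ?_⟩
      · rw [RandomGraphCore.coreProbWithoutRepl_eq, RandomGraphCore.coreProb_zero (by omega)]
        exact hp₁.le
      · rw [RandomGraphCore.coreProbWithoutRepl_eq, RandomGraphCore.coreProb_eq_one le_rfl hqn]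
        exact hp₂.le
  · refine conclude _ (RandomGraphCore.sub_le_mul_transitionWidth isLowerSet_univ ?_ ?_)
    · intro m _
      exact RandomGraphCore.coreProbWithRepl_succ_sub_le (by positivity) hn2 hn m
    · obtain ⟨m, hm⟩ := RandomGraphCore.exists_le_coreProbWithRepl hn2 hqn hp₂
      refine ⟨m, Set.mem_univ m, ?_, hm⟩
      rw [RandomGraphCore.coreProbWithRepl_zero (by omega)]
      exact hp₁.le
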